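/- Let $n_{\mathrm R}\ge 1$ and $0\le K<n_{\mathrm T}$ be integers. For $N_0>0$ and $\mathbf H\in\mathbb C^{n_{\mathrm R}\times n_{\mathrm T}}$ consider the channel $\mathbf y=\mathbf H\mathbf x+\mathbf n$, where $\mathbf x\sim\mathcal{CN}(0,\mathbf I_{n_{\mathrm T}})$ and $\mathbf n\sim\mathcal{CN}(0,N_0\mathbf I_{n_{\mathrm R}})$ are independent (circularly symmetric complex Gaussian). A channel shortening (CS) detector with memory $K$ uses the receiver function $$\tilde T(\mathbf y|\mathbf x)=\exp\bigl(2\,\mathrm{Re}\{\mathbf x^{\mathrm H}\mathbf H_{\mathrm r}\mathbf y\}-\mathbf x^{\mathrm H}\mathbf G_{\mathrm r}\mathbf x\bigr),$$ where $\mathbf H_{\mathrm r}$ is an arbitrary $n_{\mathrm T}\times n_{\mathrm R}$ matrix and $\mathbf G_{\mathrm r}$ is a Hermitian $n_{\mathrm T}\times n_{\mathrm T}$ matrix whose $(k,\ell)$ entry is zero whenever $|k-\ell|>K$, such that $\tilde T(\mathbf y)=\mathbb E_{\mathbf x}[\tilde T(\mathbf y|\mathbf x)]$ is finite for every $\mathbf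 y$ (here $\mathbb E_{\mathbf x}$ averages over $\mathbf x\sim\mathcal{CN}(0,\mathbf I_{n_{\mathrm T}})$ with $\mathbf y$ fixed). Its generalized mutual information is $$I_{\mathrm{GMI}}(\mathbf H_{\mathrm r},\mathbf G_{\mathrm r})=-\mathbb E[\log\tilde T(\mathbf y)]+\mathbb E[\log\tilde T(\mathbf y|\mathbf x)],$$ with expectations over the joint law of $(\mathbf x,\mathbf y)$. Let $I_{\mathrm{GMI}}(\mathbf H,N_0)$ be the maximum of this quantity over all such $(\mathbf H_{\mathrm r},\mathbf G_{\mathrm r})$. Now let $\mathbf H$ have i.i.d. $\mathcal{CN}(0,1)$ entries, put $N_0=n_{\mathrm T}/\mathrm{snr}$ and $R(\mathrm{snr})=\mathbb E_{\mathbf H}[I_{\mathrm{GMI}}(\mathbf H,n_{\mathrm T}/\mathrm{snr})]$. Define the high-SNR slope $S_\infty^{\mathrm{CS}}=\lim_{\mathrm{snr}\to\infty}R(\mathrm{snr})/\log(\mathrm{snr})$ and, when $S_\infty^{\mathrm{CS}}>0$, the high-SNR power offset $$L_\infty^{\mathrm{CS}}=\lim_{\mathrm{snr}\to\infty}\left(\log(\mathrm{snr})-\frac{R(\mathrm{snr})}{S_\infty^{\mathrm{CS}}}\right).$$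 For $n\ge 0$ and $\mathbf H$ an $n_{\mathrm R}\times n$ matrix with i.i.d. $\mathcal{CN}(0,1)$ entries let $$\mathcal J(n_{\mathrm R},n)=\begin{cases}\mathbb E[\log\det(\mathbf H\mathbf H^{\mathrm H})],& n_{\mathrm R}<n,\\ \mathbb E[\log\det(\mathbf H^{\mathrm H}\mathbf H)],& n_{\mathrm R}\ge n,\end{cases}$$ so that $\mathcal J(n_{\mathrm R},0)=0$; all logarithms are natural. Then the maximum defining $I_{\mathrm{GMI}}(\mathbf H,n_{\mathrm T}/\mathrm{snr})$ is attained for every $\mathbf H$ and every $\mathrm{snr}>0$, the random variables in the definitions of $R(\mathrm{snr})$ (for every $\mathrm{snr}>0$) and of $\mathcal J(n_{\mathrm R},n)$ (for every $n\le n_{\mathrm T}$) are integrable, the limit $S_\infty^{\mathrm{CS}}$ exists in $\mathbb R$, and whenever $S_\infty^{\mathrm{CS}}>0$ the limit $L_\infty^{\mathrm{CS}}$ exists and $$L_\infty^{\mathrm{CS}}=\log(n_{\mathrm T})-\frac{\mathcal J(n_{\mathrm R},n_{\mathrm T})}{S_\infty^{\mathrm{CS}}}+(n_{\mathrm T}-K)\frac{\mathcal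 J(n_{\mathrm R},n_{\mathrm T}-K-1)}{S_\infty^{\mathrm{CS}}}-(n_{\mathrm T}-K-1)\frac{\mathcal J(n_{\mathrm R},n_{\mathrm T}-K)}{S_\infty^{\mathrm{CS}}}.$$ -/

import Mathlib

open MeasureTheory ProbabilityTheory Filter Topology Matrix

noncomputable section

/-- The zero-mean circularly-symmetric complex Gaussian law of variance `v`: real and imaginary
parts are independent centred real Gaussians of variance `v / 2`. -/
def complexGaussian (v : ℝ) : Measure ℂ :=
  ((gaussianReal 0 (v / 2).toNNReal).prod (gaussianReal 0 (v / 2).toNNReal)).map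
    Complex.measurableEquivRealProd.symm

/-- The law of a vector in `ℂⁿ` with covariance `v • 1`, zero-mean circularly-symmetric complex
Gaussian: the coordinates are independent with law `complexGaussian v`. -/
def gaussianVector (n : ℕ) (v : ℝ) : Measure (Fin n → ℂ) :=
  Measure.pi fun _ => complexGaussian v

/-- The law of (the array of entries of) an `nR × nT` matrix with independent zero-mean, unit-variance
circularly-symmetric complex Gaussian entries. -/
def channelLaw (nR nT : ℕ) : Measure (Fin nR → Fin nT → ℂ) :=
  Measure.pi fun _ : Fin nR => Measure.pi fun _ : Fin nT => complexGaussian 1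

/-- The receiver function `exp (2 Re (xᴴ Hr y) - xᴴ Gr x)`. -/
def receiverFn {nR nT : ℕ} (Hr : Matrix (Fin nT) (Fin nR) ℂ) (Gr : Matrix (Fin nT) (Fin nT) ℂ)
    (y : Fin nR → ℂ) (x : Fin nT → ℂ) : ℝ :=
  Real.exp (2 * (star x ⬝ᵥ (Hr *ᵥ y)).re - (star x ⬝ᵥ (Gr *ᵥ x)).re)

/-- The receiver function averaged over the Gaussian input, as a function of the output. -/
def receiverMarginal {nR nT : ℕ} (Hr : Matrix (Fin nT) (Fin nR) ℂ)
    (Gr : Matrix (Fin nT) (Fin nT) ℂ) (y : Fin nR → ℂ) : ℝ :=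
  ∫ x, receiverFn Hr Gr y x ∂(gaussianVector nT 1)

/-- The generalized mutual information (in nats) of the channel `y = H x + n`, with input
`x ~ CN(0, 1)` and independent noise `n ~ CN(0, N0 • 1)`, for the receiver function of
parameters `Hr`, `Gr`. -/
def gmi {nR nT : ℕ} (N0 : ℝ) (H : Matrix (Fin nR) (Fin nT) ℂ)
    (Hr : Matrix (Fin nT) (Fin nR) ℂ) (Gr : Matrix (Fin nT) (Fin nT) ℂ) : ℝ :=
  -(∫ p, Real.log (receiverMarginal Hr Gr (H *ᵥ p.1 + p.2))
      ∂((gaussianVector nT 1).prod (gaussianVector nR N0)))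
  + ∫ p, Real.log (receiverFn Hr Gr (H *ᵥ p.1 + p.2) p.1)
      ∂((gaussianVector nT 1).prod (gaussianVector nR N0))

/-- The admissible parameters of a channel shortening (CS) detector with memory `K`: `Hr` is
arbitrary, `Gr` is Hermitian and vanishes off the `2K+1` central diagonals. The last field says
that the averaged receiver function is finite (where it is infinite, the generalized mutual
information is `-∞`, whereas the Bochner integral would return `0`). -/
structure IsCSReceiver {nR nT : ℕ} (K : ℕ) (Hr : Matrix (Fin nT) (Fin nR) ℂ)
    (Gr : Matrix (Fin nT) (Fin nT) ℂ) : Prop where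
  hermitian : Gr.IsHermitian
  banded : ∀ k l : Fin nT, (K : ℤ) < |((k : ℕ) : ℤ) - ((l : ℕ) : ℤ)| → Gr k l = 0
  finite : ∀ y : Fin nR → ℂ, Integrable (receiverFn Hr Gr y) (gaussianVector nT 1)

/-- The generalized mutual informations reached by CS detectors with memory `K`. -/
def csRates {nR nT : ℕ} (K : ℕ) (N0 : ℝ) (H : Matrix (Fin nR) (Fin nT) ℂ) : Set ℝ :=
  {r | ∃ (Hr : Matrix (Fin nT) (Fin nR) ℂ) (Gr : Matrix (Fin nT) (Fin nT) ℂ),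
    IsCSReceiver K Hr Gr ∧ r = gmi N0 H Hr Gr}

/-- The rate of the optimized CS detector with memory `K` on the channel `H`. -/
def csRate {nR nT : ℕ} (K : ℕ) (N0 : ℝ) (H : Matrix (Fin nR) (Fin nT) ℂ) : ℝ :=
  sSup (csRates K N0 H)

/-- The ergodic rate of the optimized CS detector with memory `K` on the `nR × nT` channel with
independent `CN(0, 1)` entries; the noise variance is `nT / snr`. -/
def ergodicCSRate (nR nT K : ℕ) (snr : ℝ) : ℝ :=
  ∫ H, csRate K (nT / snr) (Matrix.of H) ∂(channelLaw nR nT)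

/-- `S` is the high-SNR slope of the rate function `R`. -/
def IsHighSNRSlope (R : ℝ → ℝ) (S : ℝ) : Prop :=
  Tendsto (fun snr => R snr / Real.log snr) atTop (𝓝 S)

/-- `L` is the high-SNR power offset of the rate function `R` of slope `S`. -/
def IsHighSNRPowerOffset (R : ℝ → ℝ) (S L : ℝ) : Prop :=
  Tendsto (fun snr => Real.log snr - R snr / S) atTop (𝓝 L)

/-- `log det` of the smaller one of the Gram matrices `H Hᴴ` and `Hᴴ H`. -/
def logDetGram {nR n : ℕ} (H : Matrix (Fin nR) (Fin n) ℂ) : ℝ :=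
  if nR < n then Real.log (H * Hᴴ).det.re else Real.log (Hᴴ * H).det.re

/-- The expected `log det` of the Wishart Gram matrix. -/
def wishartJ (nR n : ℕ) : ℝ :=
  ∫ H, logDetGram (Matrix.of H) ∂(channelLaw nR n)

end

/-! Put `A = 1 + Gr`, `W = H Hᴴ + N0`, `Q = 1 + N0⁻¹ Hᴴ H`. The averaged receiver function is a
Gaussian integral, finite only if `A` is positive definite (`posDef_of_lintegral_ne_top`) and then
explicit (`lintegral_exp_gaussExponent`). Its logarithm is quadratic in `y`, so second moments give
the GMI. Completing the square in `Hr` leaves `log det A - tr (A Q⁻¹) + nT` minus a nonnegative term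
that vanishes at `Hr = A Hᴴ W⁻¹` (`gmi_eq_sub`).

It remains to maximize over banded `A`. One Cholesky step `A = a c cᴴ + (0 ⊕ S)` with `c 0 = 1`
splits the objective into a function of `(a, c)` and the same problem for `S`
(`log_det_schurExtend_sub_trace`). Bandedness means that each Cholesky column lives on a window of
length at most `K + 1`. The best column costs the logarithm of a ratio of principal minors of `Q⁻¹`,
so the maximum is `bandedValue`. By Jacobi's identity these minors become complementary minors of
`Q`, that is, determinants `det (1 + t Hₚᴴ Hₚ)` for column submatrices `Hₚ`.

Columns are i.i.d., so after averaging only the number of columns counts. The sum over windows then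
collapses to three terms, with `nT`, `nT - K - 1` and `nT - K` columns (`ergodicCSRate_eq`).

For each of them, `E log det (1 + t Hᴴ H) - min (nR, n) log t` tends to `wishartJ nR n` by dominated
convergence (`tendsto_ergodicLogDet_sub`). The delicate point is integrability of `log det` near
singular matrices. It follows from a finite inverse first moment of the determinant of a square
Gaussian matrix (`lintegral_enorm_det_inv_le`). Slope and offset are read off from the resulting
affine expansion in `log snr`. -/

namespace ChannelShortening

/-! ### Determinants of positive definite matrices and complementary minors. -/

section MatrixAlgebra

variable {ι κ : Type*} [Fintype ι] [DecidableEq ι] [Fintype κ] [DecidableEq κ]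

open scoped MatrixOrder ComplexOrder

lemma exists_eq_conjTranspose_mul_self {A : Matrix ι ι ℂ} (hA : A.PosDef) :
    ∃ L : Matrix ι ι ℂ, IsUnit L.det ∧ A = Lᴴ * L := by
  obtain ⟨L, hL⟩ := CStarAlgebra.nonneg_iff_eq_star_mul_self.mp hA.posSemidef.nonneg
  refine ⟨L, ?_, hL⟩
  have h := hA.det_pos.ne'
  rw [hL, det_mul] at h
  exact isUnit_iff_ne_zero.mpr (right_ne_zero_of_mul h)

lemma det_re_pos {A : Matrix ι ι ℂ} (hA : A.PosDef) : 0 < A.det.re :=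
  (Complex.pos_iff.mp hA.det_pos).1

lemma det_eq_ofReal_re {A : Matrix ι ι ℂ} (hA : A.IsHermitian) : A.det = (A.det.re : ℂ) := by
  rw [hA.det_eq_prod_eigenvalues]
  norm_cast

lemma log_det_eq_sum {A : Matrix ι ι ℂ} (hA : A.PosDef) :
    Real.log A.det.re = ∑ i, Real.log (hA.1.eigenvalues i) := by
  have h : A.det.re = ∏ i, hA.1.eigenvalues i := by
    rw [hA.1.det_eq_prod_eigenvalues]
    norm_cast
  rw [h, Real.log_prod (fun i _ => (hA.eigenvalues_pos i).ne')]

lemma trace_re_eq_sum {A : Matrix ι ι ℂ} (hA : A.IsHermitian) :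
    A.trace.re = ∑ i, hA.eigenvalues i := by
  rw [hA.trace_eq_sum_eigenvalues]
  norm_cast

/-- `log det A ≤ tr A - n` for positive definite `A`. -/
lemma log_det_le_trace_sub {A : Matrix ι ι ℂ} (hA : A.PosDef) :
    Real.log A.det.re ≤ A.trace.re - Fintype.card ι := by
  rw [log_det_eq_sum hA, trace_re_eq_sum hA.1]
  calc ∑ i, Real.log (hA.1.eigenvalues i) ≤ ∑ i, (hA.1.eigenvalues i - 1) :=
        Finset.sum_le_sum fun i _ => Real.log_le_sub_one_of_pos (hA.eigenvalues_pos i)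
    _ = _ := by simp [Finset.sum_sub_distrib]

omit [Fintype ι] in
lemma posDef_one_add {P : Matrix ι ι ℂ} (hP : P.PosSemidef) : (1 + P).PosDef :=
  PosDef.one.add_posSemidef hP

lemma one_le_det_one_add {P : Matrix ι ι ℂ} (hP : P.PosSemidef) : 1 ≤ (1 + P).det.re := by
  have h : (1 + P).det = ∏ i, ((1 + hP.1.eigenvalues i : ℝ) : ℂ) := by
    have h1 : (1 + P) = (hP.1.eigenvectorUnitary : Matrix ι ι ℂ)
        * (1 + diagonal (fun i => (hP.1.eigenvalues i : ℂ)))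
        * star (hP.1.eigenvectorUnitary : Matrix ι ι ℂ) := by
      rw [mul_add, add_mul, mul_one]
      congr 1
      · simp
      · exact hP.1.spectral_theorem
    have hUU : (hP.1.eigenvectorUnitary : Matrix ι ι ℂ)
        * star (hP.1.eigenvectorUnitary : Matrix ι ι ℂ) = 1 :=
      Unitary.mul_star_self_of_mem hP.1.eigenvectorUnitary.2
    rw [h1, det_mul_right_comm, hUU, one_mul, ← diagonal_one, diagonal_add,
      det_diagonal]
    simp
  have h2 : (1 + P).det.re = ∏ i, (1 + hP.1.eigenvalues i) := by rw [h]; norm_cast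
  rw [h2]
  calc (1 : ℝ) = ∏ _i : ι, (1 : ℝ) := by simp
    _ ≤ _ := Finset.prod_le_prod (fun _ _ => zero_le_one)
      fun i _ => by linarith [hP.eigenvalues_nonneg i]

/-- The determinant is monotone on positive semidefinite matrices. -/
lemma det_re_mono {A P : Matrix ι ι ℂ} (hA : A.PosSemidef) (hP : P.PosSemidef) :
    A.det.re ≤ (A + P).det.re := by
  have hnn : 0 ≤ (A + P).det.re := (Complex.nonneg_iff.mp (hA.add hP).det_nonneg).1
  by_cases h0 : A.det = 0
  · simpa [h0] using hnn
  have hApd : A.PosDef := by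
    rw [hA.posDef_iff_det_ne_zero]
    exact h0
  obtain ⟨L, hL, rfl⟩ := exists_eq_conjTranspose_mul_self hApd
  have hLL : IsUnit Lᴴ.det := by rw [det_conjTranspose]; exact hL.star
  -- The congruence by `L` reduces the claim to `1 ≤ det (1 + P')` with `P'` positive semidefinite.
  have h1 : Lᴴ * L + P = Lᴴ * (1 + (Lᴴ)⁻¹ * P * L⁻¹) * L := by
    rw [mul_add, add_mul, mul_one]
    congr 1
    rw [mul_assoc, mul_assoc, mul_assoc, nonsing_inv_mul _ hL, mul_one,
      mul_nonsing_inv_cancel_left _ _ hLL]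
  have hQ : ((Lᴴ)⁻¹ * P * L⁻¹).PosSemidef := by
    have := hP.conjTranspose_mul_mul_same L⁻¹
    rwa [conjTranspose_nonsing_inv] at this
  have h2 : (Lᴴ * L + P).det = (Lᴴ * L).det * (1 + (Lᴴ)⁻¹ * P * L⁻¹).det := by
    rw [h1, det_mul, det_mul, det_mul]; ring
  rw [h2, det_eq_ofReal_re hApd.1, Complex.re_ofReal_mul, Complex.ofReal_re]
  exact le_mul_of_one_le_right (det_re_pos hApd).le (one_le_det_one_add hQ)

/-- The principal minor of `B` on the indices satisfying `p`. -/
noncomputable def minorDet (B : Matrix ι ι ℂ) (p : ι → Prop) [DecidablePred p] : ℝ :=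
  (B.toSquareBlockProp p).det.re

omit [Fintype ι] [DecidableEq ι] in
lemma posDef_toSquareBlockProp {B : Matrix ι ι ℂ} (hB : B.PosDef) (p : ι → Prop)
    [DecidablePred p] : (B.toSquareBlockProp p).PosDef :=
  hB.submatrix Subtype.val_injective

lemma minorDet_pos {B : Matrix ι ι ℂ} (hB : B.PosDef) (p : ι → Prop) [DecidablePred p] :
    0 < minorDet B p :=
  det_re_pos (posDef_toSquareBlockProp hB p)

/-- Jacobi's complementary minor identity. -/
lemma det_toSquareBlockProp_mul_det {B Q : Matrix ι ι ℂ} (h : B * Q = 1) (p : ι → Prop)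
    [DecidablePred p] :
    (B.toSquareBlockProp p).det * Q.det = (Q.toSquareBlockProp fun i => ¬p i).det := by
  -- `M` takes its rows in `p` from `B` and the others from the identity. Then `M * Q` has identity
  -- rows in `p` and rows of `Q` elsewhere; both are block triangular, and taking determinants gives
  -- the identity.
  set M : Matrix ι ι ℂ := of fun i j => if p i then B i j else (1 : Matrix ι ι ℂ) i j with hM
  have hMQ : M * Q = of fun i j => if p i then (1 : Matrix ι ι ℂ) i j else Q i j := by
    ext i j
    by_cases hi : p i
    · simp only [mul_apply, hM, of_apply, hi, if_true, ← h]
    · have : (M * Q) i j = ((1 : Matrix ι ι ℂ) * Q) i j := by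
        simp only [mul_apply, hM, of_apply, hi, if_false]
      rw [this, one_mul]
      simp [hi]
  have h1 : M.det = (B.toSquareBlockProp p).det := by
    rw [twoBlockTriangular_det M p]
    · have e1 : M.toSquareBlockProp p = B.toSquareBlockProp p := by
        ext i j; simp [hM, toSquareBlockProp_def, i.2]
      have e2 : (M.toSquareBlockProp fun i => ¬p i) = 1 := by
        ext i j; simp [hM, toSquareBlockProp_def, i.2, one_apply, Subtype.ext_iff]
      rw [e1, e2, det_one, mul_one]
    · intro i hi j hj
      have : i ≠ j := fun e => hi (e ▸ hj)
      simp [hM, hi, this]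
  have h2 : (M * Q).det = (Q.toSquareBlockProp fun i => ¬p i).det := by
    rw [hMQ, twoBlockTriangular_det' _ p]
    · have e1 : (toSquareBlockProp (of fun i j => if p i then (1 : Matrix ι ι ℂ) i j else Q i j) p)
          = 1 := by
        ext i j; simp [toSquareBlockProp_def, i.2, one_apply, Subtype.ext_iff]
      have e2 : (toSquareBlockProp (of fun i j => if p i then (1 : Matrix ι ι ℂ) i j else Q i j)
          fun i => ¬p i) = Q.toSquareBlockProp fun i => ¬p i := by
        ext i j; simp [toSquareBlockProp_def, i.2]
      rw [e1, e2, det_one, one_mul]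
    · intro i hi j hj
      have : i ≠ j := fun e => hj (e ▸ hi)
      simp [hi, this]
  rw [← h2, det_mul, h1]

lemma minorDet_mul_det {B Q : Matrix ι ι ℂ} (hQ : Q.IsHermitian) (h : B * Q = 1)
    (p : ι → Prop) [DecidablePred p] :
    minorDet B p * Q.det.re = minorDet Q fun i => ¬p i := by
  have := det_toSquareBlockProp_mul_det h p
  rw [det_eq_ofReal_re hQ] at this
  have h2 := congrArg Complex.re this
  rwa [Complex.re_mul_ofReal] at h2

lemma minorDet_submatrix (B : Matrix κ κ ℂ) {e : ι → κ} (he : Function.Injective e)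
    (p : ι → Prop) (q : κ → Prop) [DecidablePred p] [DecidablePred q]
    (hpq : ∀ i, q (e i) ↔ p i) (hq : ∀ j, q j → ∃ i, e i = j) :
    minorDet (B.submatrix e e) p = minorDet B q := by
  let f : {i // p i} ≃ {j // q j} := Equiv.ofBijective (fun i => ⟨e i, (hpq i).2 i.2⟩)
    ⟨fun i j hij => Subtype.ext (he (congrArg Subtype.val hij)), fun j => by
      obtain ⟨i, hi⟩ := hq j j.2
      exact ⟨⟨i, (hpq i).1 (hi ▸ j.2)⟩, Subtype.ext hi⟩⟩
  unfold minorDet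
  rw [← det_submatrix_equiv_self f]
  rfl

end MatrixAlgebra

end ChannelShortening

namespace ChannelShortening

/-! ### Minimizing a quadratic form with one coordinate fixed. -/

section QuadraticMinimum

variable {ι : Type*} [Fintype ι] [DecidableEq ι]

open scoped ComplexOrder

omit [DecidableEq ι] in
lemma star_dotProduct_mulVec_comm {C : Matrix ι ι ℂ} (hC : C.IsHermitian) (v w : ι → ℂ) :
    star v ⬝ᵥ (C *ᵥ w) = star (C *ᵥ v) ⬝ᵥ w := by
  rw [dotProduct_mulVec, star_mulVec, hC.eq]

/-- Jacobi's identity for a single index, i.e. Cramer's rule for a diagonal entry. -/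
lemma inv_apply_mul_det {C : Matrix ι ι ℂ} (hC : C.PosDef) (i : ι) :
    (C⁻¹ i i) * (C.det.re : ℂ) = (minorDet C fun j => j ≠ i : ℝ) := by
  have hu : IsUnit C.det := (isUnit_iff_isUnit_det C).mp hC.isUnit
  have h := det_toSquareBlockProp_mul_det (nonsing_inv_mul C hu) (fun j => j = i)
  rw [← det_eq_ofReal_re hC.1]
  have h1 : ∀ (p : ι → Prop) [DecidablePred p], (∀ j, p j ↔ j = i) →
      (C⁻¹.toSquareBlockProp p).det = C⁻¹ i i := by
    intro p _ hp
    have : Subsingleton {j // p j} :=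
      ⟨fun x y => Subtype.ext (((hp x).1 x.2).trans ((hp y).1 y.2).symm)⟩
    rw [det_eq_elem_of_subsingleton _ (⟨i, (hp i).2 rfl⟩ : {j // p j})]
    rfl
  rw [h1 (fun j => j = i) fun _ => Iff.rfl] at h
  rw [h]
  exact det_eq_ofReal_re (posDef_toSquareBlockProp hC _).1

/-- The minimum of a positive definite quadratic form on vectors with `i`-th coordinate `1`. -/
lemma le_quadratic_of_apply_eq_one {C : Matrix ι ι ℂ} (hC : C.PosDef) (i : ι) {c : ι → ℂ}
    (hc : c i = 1) :
    C.det.re / (minorDet C fun j => j ≠ i) ≤ (star c ⬝ᵥ (C *ᵥ c)).re := by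
  set s : ℝ := C.det.re / (minorDet C fun j => j ≠ i) with hs
  have hm := minorDet_pos hC (fun j => j ≠ i)
  have hd := det_re_pos hC
  have hu : IsUnit C.det := (isUnit_iff_isUnit_det C).mp hC.isUnit
  set d : ι → ℂ := C⁻¹ *ᵥ Pi.single i 1
  have hCd : C *ᵥ d = Pi.single i 1 := by
    rw [mulVec_mulVec, mul_nonsing_inv C hu, one_mulVec]
  have hdi : (s : ℂ) * d i = 1 := by
    have h1 := inv_apply_mul_det hC i
    have h2 : d i = C⁻¹ i i := by simp [d]
    rw [h2, hs]
    push_cast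
    have : ((minorDet C fun j => j ≠ i : ℝ) : ℂ) ≠ 0 := by exact_mod_cast hm.ne'
    rw [div_mul_eq_mul_div, div_eq_one_iff_eq this, mul_comm, h1]
  -- The minimizer is `s • d` with `d = C⁻¹ eᵢ` and `s = 1 / (C⁻¹)ᵢᵢ`; nonnegativity of the form at
  -- the difference from it is the bound.
  have h0 := hC.posSemidef.dotProduct_mulVec_nonneg (c - (s : ℂ) • d)
  have key : star (c - (s : ℂ) • d) ⬝ᵥ (C *ᵥ (c - (s : ℂ) • d))
      = star c ⬝ᵥ (C *ᵥ c) - s := by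
    have e1 : star d ⬝ᵥ (C *ᵥ c) = 1 := by
      rw [star_dotProduct_mulVec_comm hC.1, hCd, ← Pi.single_star, star_one, single_one_dotProduct]
      exact hc
    rw [mulVec_sub, mulVec_smul, hCd]
    simp only [star_sub, star_smul, sub_dotProduct, dotProduct_sub, smul_dotProduct,
      dotProduct_smul, e1, dotProduct_single_one, smul_eq_mul]
    have hs' : star (s : ℂ) = s := Complex.conj_ofReal s
    have e2 : (s : ℂ) * star (d i) = 1 := by
      have := congrArg star hdi
      rwa [star_mul', hs', star_one] at this
    simp only [Pi.sub_apply, Pi.smul_apply, Pi.star_apply, hc, smul_eq_mul, hs', star_one]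
    linear_combination (s : ℂ) * e2
  rw [key] at h0
  have := (Complex.nonneg_iff.mp h0).1
  simpa using this

lemma exists_quadratic_eq_of_apply_eq_one {C : Matrix ι ι ℂ} (hC : C.PosDef) (i : ι) :
    ∃ c : ι → ℂ, c i = 1 ∧
      (star c ⬝ᵥ (C *ᵥ c)).re = C.det.re / (minorDet C fun j => j ≠ i) := by
  set s : ℝ := C.det.re / (minorDet C fun j => j ≠ i) with hs
  have hm := minorDet_pos hC (fun j => j ≠ i)
  have hu : IsUnit C.det := (isUnit_iff_isUnit_det C).mp hC.isUnit
  set d : ι → ℂ := C⁻¹ *ᵥ Pi.single i 1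
  have hCd : C *ᵥ d = Pi.single i 1 := by
    rw [mulVec_mulVec, mul_nonsing_inv C hu, one_mulVec]
  have hdi : (s : ℂ) * d i = 1 := by
    have h1 := inv_apply_mul_det hC i
    have h2 : d i = C⁻¹ i i := by simp [d]
    rw [h2, hs]
    push_cast
    have : ((minorDet C fun j => j ≠ i : ℝ) : ℂ) ≠ 0 := by exact_mod_cast hm.ne'
    rw [div_mul_eq_mul_div, div_eq_one_iff_eq this, mul_comm, h1]
  refine ⟨(s : ℂ) • d, hdi, ?_⟩
  rw [mulVec_smul, hCd, dotProduct_smul, dotProduct_single_one, Pi.star_apply]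
  change ((s : ℂ) * star ((s : ℂ) * d i)).re = s
  rw [hdi]
  simp

omit [DecidableEq ι] in
lemma quadratic_eq_toSquareBlockProp (B : Matrix ι ι ℂ) (p : ι → Prop) [DecidablePred p]
    {c : ι → ℂ} (hc : ∀ j, ¬p j → c j = 0) :
    star c ⬝ᵥ (B *ᵥ c) = star (fun j : {j // p j} => c j) ⬝ᵥ
      (B.toSquareBlockProp p *ᵥ fun j : {j // p j} => c j) := by
  have hsum : ∀ f : ι → ℂ, (∀ j, ¬p j → f j = 0) → ∑ j, f j = ∑ j : {j // p j}, f j := by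
    intro f hf
    rw [← Finset.sum_subtype (Finset.univ.filter p) (by simp) f, Finset.sum_filter_of_ne]
    intro j _ hj
    by_contra h
    exact hj (hf j h)
  simp only [dotProduct, mulVec]
  rw [hsum _ fun j hj => by simp [hc j hj]]
  refine Finset.sum_congr rfl fun i _ => ?_
  rw [hsum _ fun j hj => by simp [hc j hj]]
  rfl

lemma minorDet_toSquareBlockProp_ne (B : Matrix ι ι ℂ) (p : ι → Prop) [DecidablePred p] {i : ι}
    (hi : p i) :
    minorDet (B.toSquareBlockProp p) (fun j => j ≠ ⟨i, hi⟩) = minorDet B fun j => p j ∧ j ≠ i := by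
  refine minorDet_submatrix B Subtype.val_injective _ _ (fun j => ?_) fun j hj => ⟨⟨j, hj.1⟩, rfl⟩
  simp [j.2, Subtype.ext_iff]

/-- The ratio of the principal minor of `B` on `p` and the one on `p` without `i`. -/
noncomputable def minorRatio (B : Matrix ι ι ℂ) (p : ι → Prop) [DecidablePred p] (i : ι) : ℝ :=
  minorDet B p / minorDet B fun j => p j ∧ j ≠ i

lemma minorRatio_pos {B : Matrix ι ι ℂ} (hB : B.PosDef) (p : ι → Prop) [DecidablePred p] (i : ι) :
    0 < minorRatio B p i :=
  div_pos (minorDet_pos hB _) (minorDet_pos hB _)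

lemma minorRatio_le_quadratic {B : Matrix ι ι ℂ} (hB : B.PosDef) (p : ι → Prop) [DecidablePred p]
    {i : ι} (hi : p i) {c : ι → ℂ} (hci : c i = 1) (hc : ∀ j, ¬p j → c j = 0) :
    minorRatio B p i ≤ (star c ⬝ᵥ (B *ᵥ c)).re := by
  rw [quadratic_eq_toSquareBlockProp B p hc, minorRatio, ← minorDet_toSquareBlockProp_ne B p hi]
  exact le_quadratic_of_apply_eq_one (posDef_toSquareBlockProp hB p) ⟨i, hi⟩ hci

lemma exists_quadratic_eq_minorRatio {B : Matrix ι ι ℂ} (hB : B.PosDef) (p : ι → Prop)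
    [DecidablePred p] {i : ι} (hi : p i) :
    ∃ c : ι → ℂ, c i = 1 ∧ (∀ j, ¬p j → c j = 0) ∧
      (star c ⬝ᵥ (B *ᵥ c)).re = minorRatio B p i := by
  obtain ⟨v, hv, hvs⟩ :=
    exists_quadratic_eq_of_apply_eq_one (posDef_toSquareBlockProp hB p) ⟨i, hi⟩
  have hc : ∀ j, ¬p j → (fun j => if h : p j then v ⟨j, h⟩ else 0) j = 0 := fun j hj => by
    simp [hj]
  refine ⟨fun j => if h : p j then v ⟨j, h⟩ else 0, by simp [hi, hv], hc, ?_⟩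
  rw [quadratic_eq_toSquareBlockProp B p hc, minorRatio, ← minorDet_toSquareBlockProp_ne B p hi]
  have : (fun j : {j // p j} => if h : p j then v ⟨j, h⟩ else 0) = v := by
    ext j; simp [j.2]
  rw [this, hvs]
  rfl

end QuadraticMinimum
end ChannelShortening

namespace ChannelShortening

/-! ### The log-det problem over banded matrices, by Cholesky recursion. -/

section Banded

open scoped ComplexOrder

/-- A matrix vanishing off the `2 K + 1` central diagonals. -/
def IsBanded {n : ℕ} (K : ℕ) (A : Matrix (Fin n) (Fin n) ℂ) : Prop :=
  ∀ k l : Fin n, (K : ℤ) < |((k : ℕ) : ℤ) - ((l : ℕ) : ℤ)| → A k l = 0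

/-- The matrix `S` bordered by a zero row and a zero column. -/
def zeroBorder {n : ℕ} (S : Matrix (Fin n) (Fin n) ℂ) : Matrix (Fin (n + 1)) (Fin (n + 1)) ℂ :=
  of (Fin.cons 0 fun k => Fin.cons 0 fun l => S k l)

variable {n : ℕ} (S : Matrix (Fin n) (Fin n) ℂ)

@[simp] lemma zeroBorder_zero_left (l : Fin (n + 1)) : zeroBorder S 0 l = 0 := rfl

@[simp] lemma zeroBorder_zero_right (k : Fin (n + 1)) : zeroBorder S k 0 = 0 := by
  cases k using Fin.cases <;> rfl

@[simp] lemma zeroBorder_succ_succ (k l : Fin n) : zeroBorder S k.succ l.succ = S k l := rfl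

/-- The matrix with first Cholesky column `√a • c` and Schur complement `S`. -/
def schurExtend (a : ℝ) (c : Fin (n + 1) → ℂ) : Matrix (Fin (n + 1)) (Fin (n + 1)) ℂ :=
  (a : ℂ) • vecMulVec c (star c) + zeroBorder S

variable {S} {a : ℝ} {c : Fin (n + 1) → ℂ}

lemma schurExtend_apply (i j : Fin (n + 1)) :
    schurExtend S a c i j = a * (c i * star (c j)) + zeroBorder S i j := rfl

lemma det_schurExtend (hc : c 0 = 1) : (schurExtend S a c).det = a * S.det := by
  set B : Matrix (Fin (n + 1)) (Fin (n + 1)) ℂ :=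
    of fun i j => if i = 0 then (a : ℂ) * star (c j) else zeroBorder S i j with hB
  have h1 : (schurExtend S a c).det = B.det := by
    -- Subtracting `c i` times row `0` from row `i` clears the rank-one term outside row `0`.
    refine det_eq_of_forall_row_eq_smul_add_const (fun i => if i = 0 then 0 else c i) 0 (by simp) ?_
    intro i j
    by_cases hi : i = 0
    · subst hi
      simp [schurExtend_apply, hB, hc]
    · simp [schurExtend_apply, hB, hi]
      ring
  rw [h1, det_succ_column_zero, Fin.sum_univ_succ]
  have h2 : B.submatrix Fin.succ Fin.succ = S := by
    ext i j; simp [hB]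
  simp [hB, hc] at h2 ⊢
  left
  exact congrArg det h2

lemma trace_schurExtend_mul (B : Matrix (Fin (n + 1)) (Fin (n + 1)) ℂ) :
    (schurExtend S a c * B).trace
      = a * (star c ⬝ᵥ (B *ᵥ c)) + (S * B.submatrix Fin.succ Fin.succ).trace := by
  rw [schurExtend, add_mul, trace_add, smul_mul, trace_smul, smul_eq_mul]
  congr 1
  · rw [vecMulVec_mul, trace_vecMulVec, dotProduct_comm, ← dotProduct_mulVec]
  · simp [trace, mul_apply, Fin.sum_univ_succ]

lemma quadratic_schurExtend (x : Fin (n + 1) → ℂ) :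
    star x ⬝ᵥ (schurExtend S a c *ᵥ x)
      = a * (star (star c ⬝ᵥ x) * (star c ⬝ᵥ x))
        + star (fun i : Fin n => x i.succ) ⬝ᵥ (S *ᵥ fun i => x i.succ) := by
  rw [schurExtend, add_mulVec, dotProduct_add]
  congr 1
  · rw [smul_mulVec, vecMulVec_mulVec, dotProduct_smul, op_smul_eq_smul, dotProduct_smul,
      star_dotProduct x c]
    simp only [smul_eq_mul]
    ring
  · simp [dotProduct, mulVec, Fin.sum_univ_succ]

lemma schurExtend_isHermitian (hS : S.IsHermitian) : (schurExtend S a c).IsHermitian := by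
  ext i j
  have h : star (zeroBorder S j i) = zeroBorder S i j := by
    cases i using Fin.cases <;> cases j using Fin.cases <;> simp [hS.apply]
  have h2 : star (a : ℂ) = a := Complex.conj_ofReal a
  simp only [conjTranspose_apply, schurExtend_apply, star_add, h, star_mul', star_star, h2]
  ring

lemma schurExtend_posDef (ha : 0 < a) (hc : c 0 = 1) (hS : S.PosDef) :
    (schurExtend S a c).PosDef := by
  refine .of_dotProduct_mulVec_pos (schurExtend_isHermitian hS.1) fun x hx => ?_
  rw [quadratic_schurExtend]
  have ha' : (0 : ℂ) < a := by exact_mod_cast ha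
  by_cases ht : (fun i : Fin n => x i.succ) = 0
  · have hx0 : x 0 ≠ 0 := by
      intro h0
      refine hx (funext fun i => ?_)
      cases i using Fin.cases with
      | zero => exact h0
      | succ i => exact congrFun ht i
    have h1 : star c ⬝ᵥ x = x 0 := by
      have : ∀ i : Fin n, x i.succ = 0 := fun i => congrFun ht i
      simp [dotProduct, Fin.sum_univ_succ, this, hc]
    rw [ht, h1]
    simp only [mulVec_zero, dotProduct_zero, add_zero]
    exact mul_pos ha' (star_mul_self_pos (IsRegular.of_ne_zero hx0))
  · exact add_pos_of_nonneg_of_pos (mul_nonneg ha'.le (star_mul_self_nonneg _))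
      (hS.dotProduct_mulVec_pos ht)

lemma posDef_of_schurExtend_posDef (hc : c 0 = 1) (hS : S.IsHermitian)
    (h : (schurExtend S a c).PosDef) : S.PosDef := by
  refine .of_dotProduct_mulVec_pos hS fun v hv => ?_
  -- The first coordinate is chosen to make `x` orthogonal to `c`, so that only the form of `S`
  -- survives.
  set x : Fin (n + 1) → ℂ := Fin.cons (-∑ i : Fin n, star (c i.succ) * v i) v with hx
  have hxt : (fun i : Fin n => x i.succ) = v := by ext i; simp [hx]
  have h0 : star c ⬝ᵥ x = 0 := by
    simp [dotProduct, Fin.sum_univ_succ, hx, hc]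
  have hx0 : x ≠ 0 := fun h => hv (by rw [← hxt, h]; rfl)
  have := h.dotProduct_mulVec_pos hx0
  rwa [quadratic_schurExtend, h0, hxt, mul_zero, mul_zero, zero_add] at this

/-- One step of Cholesky elimination: `c` is the first column of `A` normalized by its pivot, and
`S` is the Schur complement. -/
lemma exists_eq_schurExtend {A : Matrix (Fin (n + 1)) (Fin (n + 1)) ℂ} (hA : A.PosDef) :
    ∃ (a : ℝ) (c : Fin (n + 1) → ℂ) (S : Matrix (Fin n) (Fin n) ℂ),
      0 < a ∧ c 0 = 1 ∧ S.PosDef ∧ A = schurExtend S a c ∧ (∀ i, A i 0 = a * c i) := by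
  have ha := hA.diag_pos (i := 0)
  set a : ℝ := (A 0 0).re with ha'
  have hare : A 0 0 = a := by
    rw [Complex.pos_iff] at ha
    exact Complex.ext rfl (by simpa using ha.2.symm)
  have hapos : 0 < a := (Complex.pos_iff.mp ha).1
  have hane : (a : ℂ) ≠ 0 := by exact_mod_cast hapos.ne'
  set c : Fin (n + 1) → ℂ := fun i => A i 0 / a with hc
  have hc0 : c 0 = 1 := by simp [hc, hare, hane]
  set S : Matrix (Fin n) (Fin n) ℂ :=
    of fun k l => A k.succ l.succ - a * (c k.succ * star (c l.succ)) with hS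
  have hstar : ∀ i, star (c i) = A 0 i / a := fun i => by
    have h1 : star (A i 0) = A 0 i := hA.1.apply 0 i
    have h2 : star (a : ℂ) = a := Complex.conj_ofReal a
    rw [hc]; simp only [star_div₀, h1, h2]
  have hAS : A = schurExtend S a c := by
    ext i j
    rw [schurExtend_apply]
    cases i using Fin.cases with
    | zero => rw [hc0, hstar]; simp; field_simp
    | succ i =>
      cases j using Fin.cases with
      | zero => rw [hc0]; simp [hc]; field_simp
      | succ j => simp [hS]
  have hSh : S.IsHermitian := by
    ext k l
    have h2 : star (a : ℂ) = a := Complex.conj_ofReal a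
    simp only [hS, conjTranspose_apply, of_apply, star_sub, star_mul', star_star, h2,
      hA.1.apply]
    ring
  refine ⟨a, c, S, hapos, hc0, posDef_of_schurExtend_posDef hc0 hSh (hAS ▸ hA), hAS, fun i => ?_⟩
  simp only [hc]; field_simp

/-- The indices from `i` to `i + K`. -/
def Window (K : ℕ) {n : ℕ} (i j : Fin n) : Prop := (i : ℕ) ≤ j ∧ (j : ℕ) ≤ i + K

instance (K : ℕ) {n : ℕ} (i : Fin n) : DecidablePred (Window K i) :=
  fun _ => inferInstanceAs (Decidable (_ ∧ _))

/-- The window of a successor never contains index `0`, so deleting that index changes nothing. This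
makes `bandedValue` recursive. -/
lemma minorRatio_window_succ (K : ℕ) (B : Matrix (Fin (n + 1)) (Fin (n + 1)) ℂ) (i : Fin n) :
    minorRatio (B.submatrix Fin.succ Fin.succ) (Window K i) i
      = minorRatio B (Window K i.succ) i.succ := by
  have key : ∀ j : Fin (n + 1), Window K i.succ j → ∃ k : Fin n, k.succ = j := by
    intro j hj
    refine Fin.exists_succ_eq.2 ?_
    rintro rfl
    simp [Window] at hj
  unfold minorRatio
  congr 1
  · refine minorDet_submatrix B (Fin.succ_injective n) _ _ (fun j => ?_) key
    simp only [Window, Fin.val_succ]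
    omega
  · refine minorDet_submatrix B (Fin.succ_injective n) _ _ (fun j => ?_) fun j hj => key j hj.1
    simp only [Window, Fin.val_succ, ne_eq, Fin.succ_inj]
    constructor <;> rintro ⟨h1, h2⟩ <;> exact ⟨by omega, h2⟩

/-- The maximum of `log det A - tr (A B) + n` over banded positive definite matrices `A`. -/
noncomputable def bandedValue (K : ℕ) {n : ℕ} (B : Matrix (Fin n) (Fin n) ℂ) : ℝ :=
  ∑ i, -Real.log (minorRatio B (Window K i) i)

lemma bandedValue_succ (K : ℕ) (B : Matrix (Fin (n + 1)) (Fin (n + 1)) ℂ) :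
    bandedValue K B
      = -Real.log (minorRatio B (Window K 0) 0)
        + bandedValue K (B.submatrix Fin.succ Fin.succ) := by
  simp only [bandedValue, Fin.sum_univ_succ, minorRatio_window_succ]

/-- The objective decouples: `det` is multiplicative and the trace additive in the Cholesky step, so
`(a, c)` and `S` are optimized separately. -/
lemma log_det_schurExtend_sub_trace (B : Matrix (Fin (n + 1)) (Fin (n + 1)) ℂ) (ha : 0 < a)
    (hc : c 0 = 1) (hS : S.PosDef) :
    Real.log (schurExtend S a c).det.re - (schurExtend S a c * B).trace.re + (n + 1 : ℕ)
      = (Real.log a - a * (star c ⬝ᵥ (B *ᵥ c)).re + 1)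
        + (Real.log S.det.re - (S * B.submatrix Fin.succ Fin.succ).trace.re + n) := by
  rw [det_schurExtend hc, trace_schurExtend_mul, Complex.re_ofReal_mul, Complex.add_re,
    Complex.re_ofReal_mul, Real.log_mul ha.ne' (det_re_pos hS).ne']
  push_cast
  ring

lemma log_det_sub_trace_le_bandedValue (K : ℕ) {n : ℕ} {A B : Matrix (Fin n) (Fin n) ℂ}
    (hA : A.PosDef) (hAK : IsBanded K A) (hB : B.PosDef) :
    Real.log A.det.re - (A * B).trace.re + n ≤ bandedValue K B := by
  induction n with
  | zero => simp [bandedValue]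
  | succ n ih =>
    obtain ⟨a, c, S, ha, hc, hS, rfl, hac⟩ := exists_eq_schurExtend hA
    have hane : (a : ℂ) ≠ 0 := by exact_mod_cast ha.ne'
    have hcK : ∀ j : Fin (n + 1), K < (j : ℕ) → c j = 0 := by
      intro j hj
      have h1 : schurExtend S a c j 0 = 0 := hAK j 0 (by simp; omega)
      rw [hac] at h1
      exact (mul_eq_zero.mp h1).resolve_left hane
    -- Elimination creates no fill-in: `c` vanishes beyond index `K`, so the rank-one term only
    -- touches entries already in the band.
    have hSK : IsBanded K S := by
      intro k l hkl
      have h1 := hAK k.succ l.succ (by simpa using hkl)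
      rw [schurExtend_apply, zeroBorder_succ_succ] at h1
      have h2 : c k.succ * star (c l.succ) = 0 := by
        rcases le_or_gt (k : ℕ) K with hk | hk
        · have : K < (l : ℕ) := by
            rw [lt_abs] at hkl
            omega
          rw [hcK l.succ (by simp; omega), star_zero, mul_zero]
        · rw [hcK k.succ (by simp; omega), zero_mul]
      rwa [h2, mul_zero, zero_add] at h1
    rw [log_det_schurExtend_sub_trace B ha hc hS, bandedValue_succ]
    refine add_le_add ?_ (ih hS hSK (hB.submatrix (Fin.succ_injective n)))
    have hq := minorRatio_le_quadratic hB (Window K (0 : Fin (n + 1))) (i := 0) (by simp [Window])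
      hc (fun j hj => hcK j (by simp [Window] at hj; omega))
    have hs := minorRatio_pos hB (Window K (0 : Fin (n + 1))) 0
    set q := (star c ⬝ᵥ (B *ᵥ c)).re
    have hqpos : 0 < q := hs.trans_le hq
    -- Optimization over `a`: `log (a q) ≤ a q - 1`, that is, `log a - a q + 1 ≤ -log q`.
    have h1 := Real.log_le_sub_one_of_pos (mul_pos ha hqpos)
    rw [Real.log_mul ha.ne' hqpos.ne'] at h1
    have h2 := Real.log_le_log hs hq
    linarith

lemma exists_log_det_sub_trace_eq_bandedValue (K : ℕ) {n : ℕ} {B : Matrix (Fin n) (Fin n) ℂ}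
    (hB : B.PosDef) :
    ∃ A : Matrix (Fin n) (Fin n) ℂ, A.PosDef ∧ IsBanded K A ∧
      Real.log A.det.re - (A * B).trace.re + n = bandedValue K B := by
  induction n with
  | zero => exact ⟨1, .one, fun k => k.elim0, by simp [bandedValue]⟩
  | succ n ih =>
    obtain ⟨S, hS, hSK, hSv⟩ := ih (hB.submatrix (Fin.succ_injective n))
    obtain ⟨c, hc, hcK, hcq⟩ :=
      exists_quadratic_eq_minorRatio hB (Window K (0 : Fin (n + 1))) (i := 0) (by simp [Window])
    have hs := minorRatio_pos hB (Window K (0 : Fin (n + 1))) 0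
    have hcK' : ∀ j : Fin (n + 1), K < (j : ℕ) → c j = 0 :=
      fun j hj => hcK j (by simp [Window]; omega)
    set s := minorRatio B (Window K (0 : Fin (n + 1))) 0
    -- The pivot `s⁻¹` is the maximizer of `log a - a s`.
    have ha : 0 < s⁻¹ := inv_pos.mpr hs
    refine ⟨schurExtend S s⁻¹ c, schurExtend_posDef ha hc hS, ?_, ?_⟩
    · intro k l hkl
      have h2 : c k * star (c l) = 0 := by
        rcases le_or_gt (k : ℕ) K with hk | hk
        · have : K < (l : ℕ) := by
            rw [lt_abs] at hkl
            omega
          rw [hcK' l this, star_zero, mul_zero]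
        · rw [hcK' k hk, zero_mul]
      rw [schurExtend_apply, h2, mul_zero, zero_add]
      cases k using Fin.cases with
      | zero => rfl
      | succ k =>
        cases l using Fin.cases with
        | zero => simp
        | succ l => exact hSK k l (by simpa using hkl)
    · rw [log_det_schurExtend_sub_trace B ha hc hS, bandedValue_succ, hSv, hcq,
        inv_mul_cancel₀ hs.ne', Real.log_inv]
      ring

end Banded
end ChannelShortening

namespace ChannelShortening

/-! ### Completing the square in the front-end filter. -/

section FrontEnd

open scoped ComplexOrder

variable {ι κ : Type*} [Fintype ι] [DecidableEq ι] [Fintype κ] [DecidableEq κ]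

omit [DecidableEq κ] in
lemma trace_inv_mul_quadratic_nonneg {A : Matrix ι ι ℂ} {W : Matrix κ κ ℂ} (hA : A.PosDef)
    (hW : W.PosDef) (X : Matrix ι κ ℂ) : 0 ≤ (A⁻¹ * X * W * Xᴴ).trace.re := by
  obtain ⟨L, -, hL⟩ := exists_eq_conjTranspose_mul_self hA.inv
  have h1 : (A⁻¹ * X * W * Xᴴ).trace = (L * X * W * (L * X)ᴴ).trace := by
    rw [hL, conjTranspose_mul, trace_mul_comm (L * X * W) (Xᴴ * Lᴴ), trace_mul_comm _ Xᴴ]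
    simp only [Matrix.mul_assoc]
  rw [h1]
  exact (Complex.nonneg_iff.mp (hW.posSemidef.mul_mul_conjTranspose_same (L * X)).trace_nonneg).1

/-- Expansion of the square around the optimal filter `A Hᴴ W⁻¹`. The first two terms on the right
are those of the GMI that involve `Hr`. -/
lemma trace_inv_mul_quadratic_sub {A : Matrix ι ι ℂ} {W : Matrix κ κ ℂ} (hA : A.PosDef)
    (hW : W.PosDef) (Hr : Matrix ι κ ℂ) (H : Matrix κ ι ℂ) :
    (A⁻¹ * (Hr - A * Hᴴ * W⁻¹) * W * (Hr - A * Hᴴ * W⁻¹)ᴴ).trace.re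
      = (A⁻¹ * Hr * W * Hrᴴ).trace.re - 2 * (Hr * H).trace.re + (A * (Hᴴ * W⁻¹ * H)).trace.re := by
  have hAu : IsUnit A.det := (isUnit_iff_isUnit_det A).mp hA.isUnit
  have hWu : IsUnit W.det := (isUnit_iff_isUnit_det W).mp hW.isUnit
  have e0 : (Hr - A * Hᴴ * W⁻¹)ᴴ = Hrᴴ - W⁻¹ * H * A := by
    rw [conjTranspose_sub, conjTranspose_mul, conjTranspose_mul, conjTranspose_conjTranspose,
      hA.1.eq, hW.inv.1.eq, Matrix.mul_assoc]
  have e1 : A⁻¹ * (Hr - A * Hᴴ * W⁻¹) * W = A⁻¹ * Hr * W - Hᴴ := by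
    rw [Matrix.mul_sub, Matrix.sub_mul]
    congr 1
    rw [Matrix.mul_assoc A, nonsing_inv_mul_cancel_left _ _ hAu, Matrix.mul_assoc,
      nonsing_inv_mul _ hWu, Matrix.mul_one]
  have e2 : (A⁻¹ * Hr * W * (W⁻¹ * H * A)).trace = (Hr * H).trace := by
    rw [Matrix.mul_assoc W⁻¹, ← Matrix.mul_assoc _ W⁻¹, mul_nonsing_inv_cancel_right _ _ hWu,
      trace_mul_comm, Matrix.mul_assoc H, mul_nonsing_inv_cancel_left _ _ hAu, trace_mul_comm]
  have e3 : (Hᴴ * Hrᴴ).trace.re = (Hr * H).trace.re := by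
    rw [← conjTranspose_mul, trace_conjTranspose]
    simp
  have e4 : (Hᴴ * (W⁻¹ * H * A)).trace = (A * (Hᴴ * W⁻¹ * H)).trace := by
    rw [trace_mul_comm A]
    simp only [Matrix.mul_assoc]
  rw [e1, e0, Matrix.sub_mul, Matrix.mul_sub, Matrix.mul_sub, trace_sub, trace_sub, trace_sub, e2,
    e4]
  simp only [Complex.sub_re, e3]
  ring

/-- The matrix inversion lemma. The left side is the error covariance of the linear MMSE estimate of
`x` from `y`. -/
lemma one_sub_eq_inv {H : Matrix κ ι ℂ} {N : ℝ} (hN : 0 < N) :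
    1 - Hᴴ * (H * Hᴴ + (N : ℂ) • 1)⁻¹ * H = (1 + ((N⁻¹ : ℝ) : ℂ) • (Hᴴ * H))⁻¹ := by
  have hN' : (N : ℂ) ≠ 0 := by exact_mod_cast hN.ne'
  have hW : (H * Hᴴ + (N : ℂ) • 1).PosDef :=
    PosDef.posSemidef_add (posSemidef_self_mul_conjTranspose H)
      (PosDef.one.smul (by exact_mod_cast hN))
  have hWu : IsUnit (H * Hᴴ + (N : ℂ) • 1).det := (isUnit_iff_isUnit_det _).mp hW.isUnit
  refine (inv_eq_right_inv ?_).symm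
  set W := H * Hᴴ + (N : ℂ) • (1 : Matrix κ κ ℂ) with hWdef
  have h1 : H * Hᴴ = W - (N : ℂ) • 1 := by rw [hWdef]; abel
  have h2 : (Hᴴ * H) * (Hᴴ * W⁻¹ * H) = Hᴴ * H - (N : ℂ) • (Hᴴ * W⁻¹ * H) := by
    calc (Hᴴ * H) * (Hᴴ * W⁻¹ * H) = Hᴴ * (H * Hᴴ) * W⁻¹ * H := by simp only [Matrix.mul_assoc]
      _ = _ := by
        rw [h1, Matrix.mul_sub, Matrix.sub_mul, Matrix.sub_mul, Matrix.mul_assoc Hᴴ W,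
          mul_nonsing_inv _ hWu, Matrix.mul_one]
        simp
  rw [Matrix.add_mul, Matrix.mul_sub, Matrix.mul_sub, smul_mul, smul_mul, h2, Matrix.one_mul,
    Matrix.mul_one, Matrix.one_mul, smul_sub, smul_smul]
  have : ((N⁻¹ : ℝ) : ℂ) * N = 1 := by push_cast; exact inv_mul_cancel₀ hN'
  rw [this, one_smul]
  abel

end FrontEnd

/-! ### Regularized Gram matrices and their minors. -/

section LogDet

open scoped ComplexOrder

variable {ι κ : Type*} [Fintype ι] [DecidableEq ι] [Fintype κ]

/-- The matrix `1 + t • Hᴴ H`. -/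
noncomputable def regularizedGram (t : ℝ) (H : Matrix κ ι ℂ) : Matrix ι ι ℂ :=
  1 + (t : ℂ) • (Hᴴ * H)

omit [DecidableEq ι] in
lemma posSemidef_smul_gram {t : ℝ} (ht : 0 ≤ t) (H : Matrix κ ι ℂ) :
    ((t : ℂ) • (Hᴴ * H)).PosSemidef :=
  (posSemidef_conjTranspose_mul_self H).smul (by exact_mod_cast ht)

lemma regularizedGram_posDef {t : ℝ} (ht : 0 ≤ t) (H : Matrix κ ι ℂ) :
    (regularizedGram t H).PosDef :=
  posDef_one_add (posSemidef_smul_gram ht H)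

/-- Restricting a Gram matrix to the indices in `p` amounts to keeping those columns of `H`. -/
lemma minorDet_regularizedGram (t : ℝ) (H : Matrix κ ι ℂ) (p : ι → Prop) [DecidablePred p]
    {m : ℕ} (e : Fin m ≃ {i // p i}) :
    minorDet (regularizedGram t H) p
      = (regularizedGram t (H.submatrix id fun j => (e j : ι))).det.re := by
  unfold minorDet
  rw [← det_submatrix_equiv_self e]
  congr 2
  ext i j
  simp [regularizedGram, toSquareBlockProp_def, one_apply, mul_apply, Subtype.val_inj]

/-- The value of the optimized receiver as a combination of `log det`s of column submatrices. -/
lemma bandedValue_inv_eq (K : ℕ) {n : ℕ} {Q : Matrix (Fin n) (Fin n) ℂ} (hQ : Q.PosDef) :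
    bandedValue K Q⁻¹ = ∑ i, (Real.log (minorDet Q fun j => ¬(Window K i j ∧ j ≠ i))
      - Real.log (minorDet Q fun j => ¬Window K i j)) := by
  have hQu : IsUnit Q.det := (isUnit_iff_isUnit_det _).mp hQ.isUnit
  have hd := det_re_pos hQ
  refine Finset.sum_congr rfl fun i _ => ?_
  -- Jacobi's identity turns both minors of `Q⁻¹` into complementary minors of `Q`; the common
  -- factor `det Q` cancels.
  rw [minorRatio, Real.log_div (minorDet_pos hQ.inv _).ne' (minorDet_pos hQ.inv _).ne',
    ← minorDet_mul_det hQ.1 (nonsing_inv_mul _ hQu),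
    ← minorDet_mul_det hQ.1 (nonsing_inv_mul _ hQu),
    Real.log_mul (minorDet_pos hQ.inv _).ne' hd.ne',
    Real.log_mul (minorDet_pos hQ.inv _).ne' hd.ne']
  ring

lemma log_det_regularizedGram_nonneg {t : ℝ} (ht : 0 ≤ t) (H : Matrix κ ι ℂ) :
    0 ≤ Real.log (regularizedGram t H).det.re :=
  Real.log_nonneg (one_le_det_one_add (posSemidef_smul_gram ht H))

lemma log_det_regularizedGram_le {t : ℝ} (ht : 0 ≤ t) (H : Matrix κ ι ℂ) :
    Real.log (regularizedGram t H).det.re ≤ t * ∑ i, ∑ j, ‖H i j‖ ^ 2 := by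
  have h := log_det_le_trace_sub (regularizedGram_posDef ht H)
  refine h.trans (le_of_eq ?_)
  rw [regularizedGram, trace_add, trace_one, trace_smul, smul_eq_mul, Complex.add_re,
    Complex.re_ofReal_mul, Complex.natCast_re, add_sub_cancel_left, Finset.sum_comm]
  congr 1
  simp only [trace, diag_apply, mul_apply, Complex.re_sum, conjTranspose_apply]
  refine Finset.sum_congr rfl fun i _ => Finset.sum_congr rfl fun j _ => ?_
  rw [Complex.star_def, ← Complex.normSq_eq_conj_mul_self, Complex.ofReal_re,
    Complex.normSq_eq_norm_sq]

end LogDet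
end ChannelShortening

namespace ChannelShortening

/-! ### Gaussian densities and Gaussian integrals. -/

section Density

open scoped ENNReal ComplexOrder

lemma lintegral_pi_prod_eq_prod {α : Type*} [MeasurableSpace α] (μ : Measure α) [SigmaFinite μ]
    {n : ℕ} {f : Fin n → α → ℝ≥0∞} (hf : ∀ i, Measurable (f i)) :
    ∫⁻ x, ∏ i, f i (x i) ∂(Measure.pi fun _ => μ) = ∏ i, ∫⁻ x, f i x ∂μ := by
  induction n with
  | zero => simp
  | succ n ih =>
    have h := (measurePreserving_piFinSuccAbove (fun _ : Fin (n + 1) => μ) 0).symm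
    rw [← h.lintegral_comp_emb (MeasurableEquiv.measurableEmbedding _)]
    simp only [MeasurableEquiv.piFinSuccAbove_symm_apply, Fin.insertNthEquiv_apply,
      Fin.prod_univ_succ, Fin.insertNth_zero', Fin.cons_zero, Fin.cons_succ]
    rw [lintegral_prod_mul (g := fun y : Fin n → α => ∏ i, f i.succ (y i)) (hf 0).aemeasurable
      (Finset.measurable_fun_prod _ fun i _ => (hf _).comp (measurable_pi_apply i)).aemeasurable,
      ih fun i => hf _]

lemma pi_withDensity {α : Type*} [MeasurableSpace α] (μ : Measure α) [SigmaFinite μ]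
    {f : α → ℝ≥0∞} (hf : Measurable f) [SigmaFinite (μ.withDensity f)] (n : ℕ) :
    Measure.pi (fun _ : Fin n => μ.withDensity f)
      = (Measure.pi fun _ => μ).withDensity fun x => ∏ i, f (x i) := by
  refine Measure.pi_eq fun s hs => ?_
  rw [withDensity_apply _ (MeasurableSet.univ_pi hs),
    ← lintegral_indicator (MeasurableSet.univ_pi hs)]
  have h : ((Set.univ.pi s).indicator fun x : Fin n → α => ∏ i, f (x i))
      = fun x => ∏ i, (s i).indicator f (x i) := by
    ext x
    by_cases hx : x ∈ Set.univ.pi s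
    · rw [Set.indicator_of_mem hx]
      exact Finset.prod_congr rfl fun i _ => (Set.indicator_of_mem (hx i (Set.mem_univ i)) f).symm
    · rw [Set.indicator_of_notMem hx]
      simp only [Set.mem_pi, Set.mem_univ, true_implies, not_forall] at hx
      obtain ⟨i, hi⟩ := hx
      exact (Finset.prod_eq_zero (Finset.mem_univ i) (Set.indicator_of_notMem hi f)).symm
  rw [h, lintegral_pi_prod_eq_prod μ fun i => hf.indicator (hs i)]
  refine Finset.prod_congr rfl fun i _ => ?_
  rw [lintegral_indicator (hs i), withDensity_apply _ (hs i)]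

instance (v : ℝ) : IsProbabilityMeasure (complexGaussian v) :=
  Measure.isProbabilityMeasure_map (MeasurableEquiv.measurable _).aemeasurable

instance (n : ℕ) (v : ℝ) : IsProbabilityMeasure (gaussianVector n v) := by
  unfold gaussianVector; infer_instance

instance (m n : ℕ) : IsProbabilityMeasure (channelLaw m n) := by
  unfold channelLaw; infer_instance

lemma complexGaussian_one_eq_withDensity :
    complexGaussian 1
      = volume.withDensity fun z => ENNReal.ofReal (Real.pi⁻¹ * Real.exp (-‖z‖ ^ 2)) := by
  have hv : ((1 : ℝ) / 2).toNNReal ≠ 0 := by simp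
  have hpdf : ∀ x : ℝ, gaussianPDFReal 0 ((1 : ℝ) / 2).toNNReal x
      = (√Real.pi)⁻¹ * Real.exp (-x ^ 2) := by
    intro x
    rw [gaussianPDFReal_def, Real.coe_toNNReal _ (by norm_num)]
    ring_nf
  rw [complexGaussian, gaussianReal_of_var_ne_zero 0 hv,
    prod_withDensity (measurable_gaussianPDF _ _) (measurable_gaussianPDF _ _)]
  ext s hs
  rw [Measure.map_apply (MeasurableEquiv.measurable _) hs, withDensity_apply _ hs,
    withDensity_apply _ (MeasurableEquiv.measurable _ hs),
    ← Complex.volume_preserving_equiv_real_prod.symm.setLIntegral_comp_preimage_emb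
      (MeasurableEquiv.measurableEmbedding _)]
  refine lintegral_congr fun p => ?_
  have hp : ‖Complex.measurableEquivRealProd.symm p‖ ^ 2 = p.1 ^ 2 + p.2 ^ 2 := by
    rw [← Complex.normSq_eq_norm_sq, Complex.normSq_apply]
    simp [Complex.measurableEquivRealProd_symm_apply, sq]
  rw [gaussianPDF, gaussianPDF, hpdf, hpdf, ← ENNReal.ofReal_mul (by positivity), hp]
  congr 1
  rw [neg_add, Real.exp_add]
  have : Real.pi⁻¹ = (√Real.pi)⁻¹ * (√Real.pi)⁻¹ := by
    rw [← mul_inv, Real.mul_self_sqrt Real.pi_pos.le]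
  rw [this]
  ring

lemma star_dotProduct_self_re {ι : Type*} [Fintype ι] (x : ι → ℂ) :
    (star x ⬝ᵥ x).re = ∑ i, ‖x i‖ ^ 2 := by
  simp only [dotProduct, Complex.re_sum, Pi.star_apply]
  refine Finset.sum_congr rfl fun i _ => ?_
  rw [Complex.star_def, ← Complex.normSq_eq_conj_mul_self, Complex.ofReal_re,
    Complex.normSq_eq_norm_sq]

lemma gaussianVector_one_eq_withDensity (n : ℕ) :
    gaussianVector n 1 = (volume : Measure (Fin n → ℂ)).withDensity fun x =>
      ENNReal.ofReal (Real.pi⁻¹ ^ n * Real.exp (-(star x ⬝ᵥ x).re)) := by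
  have : SigmaFinite ((volume : Measure ℂ).withDensity
      fun z => ENNReal.ofReal (Real.pi⁻¹ * Real.exp (-‖z‖ ^ 2))) := by
    rw [← complexGaussian_one_eq_withDensity]; infer_instance
  rw [gaussianVector, complexGaussian_one_eq_withDensity, pi_withDensity _ (by fun_prop)]
  congr 1
  ext x
  rw [← ENNReal.ofReal_prod_of_nonneg fun i _ => by positivity, Finset.prod_mul_distrib,
    ← Real.exp_sum, star_dotProduct_self_re]
  simp

/-- As a real-linear map, `M` has determinant `‖det M‖ ^ 2`, the norm of its complex determinant. -/
lemma lintegral_comp_mulVec {n : ℕ} {M : Matrix (Fin n) (Fin n) ℂ} (hM : M.det ≠ 0)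
    {f : (Fin n → ℂ) → ℝ≥0∞} (hf : Measurable f) :
    ∫⁻ x, f (M *ᵥ x) = ENNReal.ofReal (‖M.det‖ ^ 2)⁻¹ * ∫⁻ x, f x := by
  set T : (Fin n → ℂ) →ₗ[ℝ] (Fin n → ℂ) := (Matrix.toLin' M).restrictScalars ℝ with hT
  have hdet : LinearMap.det T = ‖M.det‖ ^ 2 := by
    rw [hT, LinearMap.det_restrictScalars, LinearMap.det_toLin', Algebra.norm_complex_apply,
      Complex.normSq_eq_norm_sq]
  have hdet0 : LinearMap.det T ≠ 0 := by rw [hdet]; positivity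
  have hmap := Measure.map_linearMap_addHaar_eq_smul_addHaar (volume : Measure (Fin n → ℂ)) hdet0
  have hTm : Measurable T := (LinearMap.continuous_of_finiteDimensional T).measurable
  calc ∫⁻ x, f (M *ᵥ x) = ∫⁻ x, f (T x) := rfl
    _ = ∫⁻ x, f x ∂(Measure.map T volume) := (lintegral_map hf hTm).symm
    _ = _ := by
      rw [hmap, lintegral_smul_measure, hdet, abs_of_nonneg (by positivity), smul_eq_mul]

/-- The exponent of the receiver function weighted with the Gaussian density. -/
def gaussExponent {n : ℕ} (A : Matrix (Fin n) (Fin n) ℂ) (b x : Fin n → ℂ) : ℝ :=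
  2 * (star x ⬝ᵥ b).re - (star x ⬝ᵥ (A *ᵥ x)).re

lemma continuous_gaussExponent {n : ℕ} (A : Matrix (Fin n) (Fin n) ℂ) (b : Fin n → ℂ) :
    Continuous (gaussExponent A b) := by
  unfold gaussExponent
  refine .sub (continuous_const.mul (Complex.continuous_re.comp ?_)) (Complex.continuous_re.comp ?_)
  · exact (continuous_star.comp continuous_id).dotProduct continuous_const
  · exact (continuous_star.comp continuous_id).dotProduct
      (continuous_const.matrix_mulVec continuous_id)

/-- The input density contributes `-xᴴ x` to the exponent; this is why `1 + Gr` is the natural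
variable. -/
lemma lintegral_exp_gaussianVector {n : ℕ} (G : Matrix (Fin n) (Fin n) ℂ) (b : Fin n → ℂ) :
    ∫⁻ x, ENNReal.ofReal (Real.exp (gaussExponent G b x)) ∂(gaussianVector n 1)
      = ENNReal.ofReal (Real.pi⁻¹ ^ n)
        * ∫⁻ x, ENNReal.ofReal (Real.exp (gaussExponent (1 + G) b x)) := by
  have hm : ∀ A : Matrix (Fin n) (Fin n) ℂ,
      Measurable fun x => ENNReal.ofReal (Real.exp (gaussExponent A b x)) := fun A =>
    (Real.continuous_exp.comp (continuous_gaussExponent A b)).measurable.ennreal_ofReal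
  have hc : Continuous fun x : Fin n → ℂ => (star x ⬝ᵥ x).re :=
    Complex.continuous_re.comp ((continuous_star.comp continuous_id).dotProduct continuous_id)
  rw [gaussianVector_one_eq_withDensity, lintegral_withDensity_eq_lintegral_mul _
      (by fun_prop) (hm G), ← lintegral_const_mul _ (hm _)]
  refine lintegral_congr fun x => ?_
  rw [Pi.mul_apply, ← ENNReal.ofReal_mul (by positivity), ← ENNReal.ofReal_mul (by positivity),
    mul_assoc, ← Real.exp_add]
  congr 3
  simp only [gaussExponent, add_mulVec, one_mulVec, dotProduct_add, Complex.add_re]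
  ring

/-- The normalizing constant comes for free, from the total mass `1` of the Gaussian law. -/
lemma lintegral_exp_neg_normSq (n : ℕ) :
    ENNReal.ofReal (Real.pi⁻¹ ^ n)
      * ∫⁻ x : Fin n → ℂ, ENNReal.ofReal (Real.exp (-(star x ⬝ᵥ x).re)) = 1 := by
  have h := lintegral_exp_gaussianVector (0 : Matrix (Fin n) (Fin n) ℂ) 0
  simpa [gaussExponent] using h.symm

/-- The Gaussian integral of the exponential of a quadratic polynomial. -/
lemma lintegral_exp_gaussExponent {n : ℕ} {A : Matrix (Fin n) (Fin n) ℂ} (hA : A.PosDef)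
    (b : Fin n → ℂ) :
    ENNReal.ofReal (Real.pi⁻¹ ^ n) * ∫⁻ x, ENNReal.ofReal (Real.exp (gaussExponent A b x))
      = ENNReal.ofReal (A.det.re⁻¹ * Real.exp (star b ⬝ᵥ (A⁻¹ *ᵥ b)).re) := by
  obtain ⟨L, hL, hAL⟩ := exists_eq_conjTranspose_mul_self hA
  have hAu : IsUnit A.det := (isUnit_iff_isUnit_det A).mp hA.isUnit
  have hLd : L.det ≠ 0 := hL.ne_zero
  -- With this shift the exponent is `bᴴ A⁻¹ b - ‖L x - d‖²`; a translation and the change of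
  -- variables `L` finish.
  set d : Fin n → ℂ := L *ᵥ (A⁻¹ *ᵥ b) with hd
  have hLd' : Lᴴ *ᵥ d = b := by
    rw [hd, mulVec_mulVec, ← hAL, mulVec_mulVec, mul_nonsing_inv _ hAu, one_mulVec]
  have hdd : star d ⬝ᵥ d = star b ⬝ᵥ (A⁻¹ *ᵥ b) := by
    have h := star_mulVec Lᴴ d
    rw [conjTranspose_conjTranspose, hLd'] at h
    rw [h, ← dotProduct_mulVec]
  have hexp : ∀ x, gaussExponent A b x = (star b ⬝ᵥ (A⁻¹ *ᵥ b)).re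
      - (star (L *ᵥ x - d) ⬝ᵥ (L *ᵥ x - d)).re := by
    intro x
    have e1 : star (L *ᵥ x) ⬝ᵥ (L *ᵥ x) = star x ⬝ᵥ (A *ᵥ x) := by
      rw [star_mulVec, ← dotProduct_mulVec, mulVec_mulVec, hAL]
    have e2 : star (L *ᵥ x) ⬝ᵥ d = star x ⬝ᵥ b := by
      rw [star_mulVec, ← dotProduct_mulVec, hLd']
    have e3 : (star d ⬝ᵥ (L *ᵥ x)).re = (star x ⬝ᵥ b).re := by
      rw [← e2, star_dotProduct]
      simp
    rw [star_sub, sub_dotProduct, dotProduct_sub, dotProduct_sub, e1, e2, hdd]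
    simp only [Complex.sub_re, e3, gaussExponent]
    ring
  have hm : Measurable fun x : Fin n → ℂ => ENNReal.ofReal (Real.exp (-(star x ⬝ᵥ x).re)) :=
    (Real.continuous_exp.comp (Complex.continuous_re.comp
      ((continuous_star.comp continuous_id).dotProduct
        continuous_id)).neg).measurable.ennreal_ofReal
  have hm' : Measurable fun x : Fin n → ℂ =>
      ENNReal.ofReal (Real.exp (-(star (x - d) ⬝ᵥ (x - d)).re)) :=
    hm.comp (measurable_id.sub_const d)
  have h1 : ∫⁻ x, ENNReal.ofReal (Real.exp (gaussExponent A b x))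
      = ENNReal.ofReal (Real.exp (star b ⬝ᵥ (A⁻¹ *ᵥ b)).re) * (ENNReal.ofReal (‖L.det‖ ^ 2)⁻¹
        * ∫⁻ x : Fin n → ℂ, ENNReal.ofReal (Real.exp (-(star x ⬝ᵥ x).re))) := by
    rw [← lintegral_sub_right_eq_self (fun x : Fin n → ℂ =>
        ENNReal.ofReal (Real.exp (-(star x ⬝ᵥ x).re))) d,
      ← lintegral_comp_mulVec hLd hm',
      ← lintegral_const_mul]
    · refine lintegral_congr fun x => ?_
      rw [hexp, sub_eq_add_neg, Real.exp_add, ENNReal.ofReal_mul (by positivity)]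
    · exact hm'.comp (continuous_const.matrix_mulVec continuous_id).measurable
  have hdet : A.det.re = ‖L.det‖ ^ 2 := by
    rw [hAL, det_mul, det_conjTranspose, Complex.star_def, ← Complex.normSq_eq_conj_mul_self,
      Complex.ofReal_re, Complex.normSq_eq_norm_sq]
  rw [h1, mul_left_comm, mul_left_comm (ENNReal.ofReal (Real.pi⁻¹ ^ n)),
    lintegral_exp_neg_normSq, mul_one, ← ENNReal.ofReal_mul (by positivity), hdet, mul_comm]

end Density
end ChannelShortening

namespace ChannelShortening

/-! ### Finiteness and closed form of the averaged receiver function. -/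

section Marginal

open scoped ENNReal ComplexOrder

/-- Suppose a unit eigenvector `v` has eigenvalue at most `0`. Stretching by `2` along `v` does not
decrease the integrand, while the change of variables divides the integral `F` by `4`. Hence `F ≤ F
/ 4`, impossible for `0 < F < ∞`. -/
lemma posDef_of_lintegral_ne_top {n : ℕ} {A : Matrix (Fin n) (Fin n) ℂ} (hA : A.IsHermitian)
    (hfin : ∫⁻ x, ENNReal.ofReal (Real.exp (gaussExponent A 0 x)) ≠ ∞) : A.PosDef := by
  rw [hA.posDef_iff_eigenvalues_pos]
  by_contra! hcon
  obtain ⟨i, hi⟩ := hcon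
  set lam := hA.eigenvalues i
  set v : Fin n → ℂ := ⇑(hA.eigenvectorBasis i) with hv
  have hAv : A *ᵥ v = (lam : ℂ) • v := by
    have := hA.mulVec_eigenvectorBasis i
    rw [← hv] at this
    rw [this]
    ext j; simp [lam]
  have hvv : star v ⬝ᵥ v = 1 := by
    have h := hA.eigenvectorBasis.orthonormal.1 i
    have h2 : (star v ⬝ᵥ v).re = 1 := by
      rw [star_dotProduct_self_re]
      rw [EuclideanSpace.norm_eq, Real.sqrt_eq_one] at h
      exact h
    have h3 : (star v ⬝ᵥ v).im = 0 := (Complex.nonneg_iff.mp (dotProduct_star_self_nonneg v)).2.symm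
    exact Complex.ext h2 h3
  set M : Matrix (Fin n) (Fin n) ℂ := 1 + vecMulVec v (star v) with hM
  have hMdet : M.det = 2 := by
    have : M = 1 + replicateCol Unit v * replicateRow Unit (star v) := by
      rw [hM, vecMulVec_eq Unit]
    rw [this, det_one_add_replicateCol_mul_replicateRow, hvv]
    norm_num
  have hMx : ∀ x, M *ᵥ x = x + (star v ⬝ᵥ x) • v := by
    intro x
    rw [hM, add_mulVec, one_mulVec, vecMulVec_mulVec, op_smul_eq_smul]
  -- The component along `v` is doubled, so its share of the form grows by `2 ^ 2 - 1 = 3` times.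
  have hquad : ∀ x, (star (M *ᵥ x) ⬝ᵥ (A *ᵥ (M *ᵥ x))).re
      = (star x ⬝ᵥ (A *ᵥ x)).re + 3 * lam * ‖star v ⬝ᵥ x‖ ^ 2 := by
    intro x
    set t := star v ⬝ᵥ x with ht
    have e1 : star v ⬝ᵥ (A *ᵥ x) = lam * t := by
      rw [star_dotProduct_mulVec_comm hA, hAv, star_smul, smul_dotProduct, Complex.star_def,
        Complex.conj_ofReal, smul_eq_mul]
    have e2 : star x ⬝ᵥ v = star t := by rw [ht, star_dotProduct x v]
    have e3 : star (M *ᵥ x) ⬝ᵥ (A *ᵥ (M *ᵥ x))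
        = star x ⬝ᵥ (A *ᵥ x) + ((3 * lam * ‖t‖ ^ 2 : ℝ) : ℂ) := by
      have e4 : star t * t = ((‖t‖ ^ 2 : ℝ) : ℂ) := by
        rw [Complex.star_def, ← Complex.normSq_eq_conj_mul_self, Complex.normSq_eq_norm_sq]
      rw [hMx, mulVec_add, mulVec_smul, hAv, star_add, star_smul]
      simp only [add_dotProduct, dotProduct_add, smul_dotProduct, dotProduct_smul, smul_eq_mul, e1,
        e2, hvv]
      push_cast at e4 ⊢
      linear_combination (3 * lam : ℂ) * e4
    rw [e3, Complex.add_re, Complex.ofReal_re]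
  have hm : Measurable fun x => ENNReal.ofReal (Real.exp (gaussExponent A 0 x)) :=
    (Real.continuous_exp.comp (continuous_gaussExponent A 0)).measurable.ennreal_ofReal
  set F := ∫⁻ x, ENNReal.ofReal (Real.exp (gaussExponent A 0 x)) with hF
  have hle : F ≤ ENNReal.ofReal (‖M.det‖ ^ 2)⁻¹ * F := by
    rw [hF, ← lintegral_comp_mulVec (by rw [hMdet]; norm_num) hm]
    refine lintegral_mono fun x => ENNReal.ofReal_le_ofReal (Real.exp_le_exp.mpr ?_)
    simp only [gaussExponent, dotProduct_zero, hquad]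
    have : lam * ‖star v ⬝ᵥ x‖ ^ 2 ≤ 0 := mul_nonpos_of_nonpos_of_nonneg hi (by positivity)
    simp only [Complex.zero_re]
    linarith
  have hF0 : F ≠ 0 := by
    rw [hF, Ne, lintegral_eq_zero_iff hm]
    intro h
    have : ∀ᵐ x : Fin n → ℂ, False := by
      filter_upwards [h] with x hx
      simp only [Pi.zero_apply, ENNReal.ofReal_eq_zero] at hx
      exact absurd hx (not_le.mpr (Real.exp_pos _))
    have h2 := ae_iff.mp this
    simp only [not_false_eq_true, Set.ofPred_true] at h2
    exact (isOpen_univ.measure_pos volume Set.univ_nonempty).ne' h2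
  have hlt : ENNReal.ofReal (‖M.det‖ ^ 2)⁻¹ < 1 := by
    rw [hMdet, ← ENNReal.ofReal_one, ENNReal.ofReal_lt_ofReal_iff one_pos]
    norm_num
  have := ENNReal.mul_lt_mul_left hF0 hfin hlt
  rw [one_mul] at this
  exact absurd hle (not_le.mpr this)

variable {nR nT : ℕ} (Hr : Matrix (Fin nT) (Fin nR) ℂ) {Gr : Matrix (Fin nT) (Fin nT) ℂ}

lemma receiverFn_eq (y : Fin nR → ℂ) :
    receiverFn Hr Gr y = fun x => Real.exp (gaussExponent Gr (Hr *ᵥ y) x) := rfl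

lemma receiverFn_nonneg (y : Fin nR → ℂ) (x : Fin nT → ℂ) : 0 ≤ receiverFn Hr Gr y x :=
  (Real.exp_pos _).le

lemma continuous_receiverFn (y : Fin nR → ℂ) : Continuous (receiverFn Hr Gr y) :=
  Real.continuous_exp.comp (continuous_gaussExponent _ _)

lemma lintegral_receiverFn (hG : (1 + Gr).PosDef) (y : Fin nR → ℂ) :
    ∫⁻ x, ENNReal.ofReal (receiverFn Hr Gr y x) ∂(gaussianVector nT 1)
      = ENNReal.ofReal ((1 + Gr).det.re⁻¹
        * Real.exp (star (Hr *ᵥ y) ⬝ᵥ ((1 + Gr)⁻¹ *ᵥ (Hr *ᵥ y))).re) := by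
  rw [receiverFn_eq, lintegral_exp_gaussianVector, lintegral_exp_gaussExponent hG]

lemma integrable_receiverFn (hG : (1 + Gr).PosDef) (y : Fin nR → ℂ) :
    Integrable (receiverFn Hr Gr y) (gaussianVector nT 1) := by
  refine ⟨(continuous_receiverFn Hr y).aestronglyMeasurable, ?_⟩
  rw [hasFiniteIntegral_iff_ofReal (ae_of_all _ (receiverFn_nonneg Hr _)),
    lintegral_receiverFn Hr hG]
  exact ENNReal.ofReal_lt_top

lemma receiverMarginal_eq (hG : (1 + Gr).PosDef) (y : Fin nR → ℂ) :
    receiverMarginal Hr Gr y = (1 + Gr).det.re⁻¹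
        * Real.exp (star (Hr *ᵥ y) ⬝ᵥ ((1 + Gr)⁻¹ *ᵥ (Hr *ᵥ y))).re := by
  rw [receiverMarginal, integral_eq_lintegral_of_nonneg_ae
      (ae_of_all _ (receiverFn_nonneg Hr _))
      (continuous_receiverFn Hr y).aestronglyMeasurable, lintegral_receiverFn Hr hG,
    ENNReal.toReal_ofReal]
  exact mul_nonneg (inv_nonneg.mpr (det_re_pos hG).le) (Real.exp_pos _).le

variable {Hr} in
lemma posDef_one_add_of_isCSReceiver {K : ℕ} (h : IsCSReceiver K Hr Gr) : (1 + Gr).PosDef := by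
  refine posDef_of_lintegral_ne_top (isHermitian_one.add h.hermitian) fun htop => ?_
  -- Finiteness at `y = 0` is enough, since the linear term then disappears.
  have h1 := (hasFiniteIntegral_iff_ofReal (ae_of_all _ (receiverFn_nonneg Hr 0))).mp
    (h.finite 0).2
  rw [receiverFn_eq, mulVec_zero, lintegral_exp_gaussianVector, htop, ENNReal.mul_top] at h1
  · exact lt_irrefl _ h1
  · rw [Ne, ENNReal.ofReal_eq_zero, not_le]
    positivity

end Marginal

/-! ### Second moments of complex Gaussian vectors. -/

section Moments

/-- The pair correlations of `u` and `w` are integrable, with matrix of expectations `C`. -/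
def HasCorrelation {Ω ι κ : Type*} [MeasurableSpace Ω] (μ : Measure Ω) (u : Ω → ι → ℂ)
    (w : Ω → κ → ℂ) (C : Matrix κ ι ℂ) : Prop :=
  ∀ i j, Integrable (fun o => star (u o i) * w o j) μ ∧ ∫ o, star (u o i) * w o j ∂μ = C j i

namespace HasCorrelation

variable {Ω ι κ τ : Type*} [MeasurableSpace Ω] {μ : Measure Ω}
  {u : Ω → ι → ℂ} {w w' : Ω → κ → ℂ} {C C' : Matrix κ ι ℂ}

lemma add (h : HasCorrelation μ u w C) (h' : HasCorrelation μ u w' C') :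
    HasCorrelation μ u (fun o => w o + w' o) (C + C') := by
  intro i j
  simp only [Pi.add_apply, mul_add]
  refine ⟨(h i j).1.add (h' i j).1, ?_⟩
  rw [integral_add (h i j).1 (h' i j).1, (h i j).2, (h' i j).2]
  rfl

lemma mulVec [Fintype κ] (h : HasCorrelation μ u w C) (M : Matrix τ κ ℂ) :
    HasCorrelation μ u (fun o => M *ᵥ w o) (M * C) := by
  intro i j
  have e : (fun o => star (u o i) * (M *ᵥ w o) j)
      = fun o => ∑ k, M j k * (star (u o i) * w o k) := by
    ext o
    simp only [Matrix.mulVec, dotProduct, Finset.mul_sum]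
    exact Finset.sum_congr rfl fun k _ => by ring
  rw [e]
  refine ⟨integrable_finsetSum _ fun k _ => (h i k).1.const_mul _, ?_⟩
  rw [integral_finsetSum _ fun k _ => (h i k).1.const_mul _, mul_apply]
  refine Finset.sum_congr rfl fun k _ => ?_
  rw [integral_const_mul, (h i k).2]

lemma swap (h : HasCorrelation μ u w C) : HasCorrelation μ w u Cᴴ := by
  intro j i
  have e : (fun o => star (w o j) * u o i) = fun o => star (star (u o i) * w o j) := by
    ext o
    rw [star_mul', star_star, mul_comm]
  rw [e]
  refine ⟨Complex.conjLIE.toContinuousLinearEquiv.toContinuousLinearMap.integrable_comp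
    (h i j).1, ?_⟩
  rw [conjTranspose_apply, ← (h i j).2]
  exact integral_conj

lemma quadratic [Fintype ι] [Fintype κ] (h : HasCorrelation μ u w C) (M : Matrix ι κ ℂ) :
    Integrable (fun o => (star (u o) ⬝ᵥ (M *ᵥ w o)).re) μ ∧
      ∫ o, (star (u o) ⬝ᵥ (M *ᵥ w o)).re ∂μ = (M * C).trace.re := by
  have h' := h.mulVec M
  have hi : Integrable (fun o => star (u o) ⬝ᵥ (M *ᵥ w o)) μ :=
    integrable_finsetSum _ fun i _ => (h' i i).1
  refine ⟨hi.re, ?_⟩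
  have : ∫ o, star (u o) ⬝ᵥ (M *ᵥ w o) ∂μ = (M * C).trace := by
    simp only [dotProduct, Pi.star_apply]
    rw [integral_finsetSum _ fun i _ => (h' i i).1]
    exact Finset.sum_congr rfl fun i _ => (h' i i).2
  rw [← this]
  exact integral_re hi

end HasCorrelation

lemma integrable_complexGaussian_iff {v : ℝ} {E : Type*} [NormedAddCommGroup E] {f : ℂ → E} :
    Integrable f (complexGaussian v) ↔ Integrable (fun p : ℝ × ℝ => f ⟨p.1, p.2⟩)
      ((gaussianReal 0 (v / 2).toNNReal).prod (gaussianReal 0 (v / 2).toNNReal)) :=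
  integrable_map_equiv Complex.measurableEquivRealProd.symm f

lemma integral_complexGaussian {v : ℝ} {E : Type*} [NormedAddCommGroup E] [NormedSpace ℝ E]
    (f : ℂ → E) : ∫ z, f z ∂(complexGaussian v) = ∫ p : ℝ × ℝ, f ⟨p.1, p.2⟩
      ∂((gaussianReal 0 (v / 2).toNNReal).prod (gaussianReal 0 (v / 2).toNNReal)) :=
  integral_map_equiv Complex.measurableEquivRealProd.symm f

lemma integrable_sq_gaussianReal (s : NNReal) :
    Integrable (fun x : ℝ => x ^ 2) (gaussianReal 0 s) :=
  (memLp_id_gaussianReal 2).integrable_sq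

lemma integral_sq_gaussianReal (s : NNReal) : ∫ x, x ^ 2 ∂(gaussianReal 0 s) = s := by
  have h := variance_id_gaussianReal (μ := 0) (v := s)
  rw [variance_of_integral_eq_zero measurable_id.aemeasurable
    (by simp)] at h
  simpa using h

lemma memLp_complexGaussian (v : ℝ) : MemLp (fun z : ℂ => z) 2 (complexGaussian v) := by
  refine (memLp_two_iff_integrable_sq_norm measurable_id.aestronglyMeasurable).mpr ?_
  rw [integrable_complexGaussian_iff]
  have e : (fun p : ℝ × ℝ => ‖(⟨p.1, p.2⟩ : ℂ)‖ ^ 2) = fun p => p.1 ^ 2 + p.2 ^ 2 := by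
    ext p
    rw [← Complex.normSq_eq_norm_sq, Complex.normSq_mk]
    ring
  simp only [id, e]
  exact (integrable_sq_gaussianReal _).comp_fst _ |>.add ((integrable_sq_gaussianReal _).comp_snd _)

lemma integral_complexGaussian_id (v : ℝ) : ∫ z, z ∂(complexGaussian v) = 0 := by
  have hi : Integrable (fun z : ℂ => z) (complexGaussian v) :=
    (memLp_complexGaussian v).integrable one_le_two
  apply Complex.ext
  · rw [← Complex.reCLM_apply, ← Complex.reCLM.integral_comp_comm hi, integral_complexGaussian]
    simp only [Complex.reCLM_apply]
    rw [integral_fun_fst (fun x : ℝ => x)]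
    simp
  · rw [← Complex.imCLM_apply, ← Complex.imCLM.integral_comp_comm hi, integral_complexGaussian]
    simp only [Complex.imCLM_apply]
    rw [integral_fun_snd (fun x : ℝ => x)]
    simp

lemma integral_star_mul_self_complexGaussian {v : ℝ} (hv : 0 ≤ v) :
    ∫ z, star z * z ∂(complexGaussian v) = v := by
  have e : (fun p : ℝ × ℝ => star (⟨p.1, p.2⟩ : ℂ) * ⟨p.1, p.2⟩)
      = fun p => ((p.1 ^ 2 + p.2 ^ 2 : ℝ) : ℂ) := by
    ext p
    rw [Complex.star_def, ← Complex.normSq_eq_conj_mul_self, Complex.normSq_mk]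
    congr 1
    ring
  rw [integral_complexGaussian, e, integral_complex_ofReal, integral_add
    ((integrable_sq_gaussianReal _).comp_fst _) ((integrable_sq_gaussianReal _).comp_snd _),
    integral_fun_fst (fun x : ℝ => x ^ 2), integral_fun_snd (fun x : ℝ => x ^ 2)]
  simp only [integral_sq_gaussianReal, probReal_univ, one_smul]
  rw [Real.coe_toNNReal _ (by positivity), add_halves]

lemma memLp_eval_gaussianVector (n : ℕ) (v : ℝ) (i : Fin n) :
    MemLp (fun x : Fin n → ℂ => x i) 2 (gaussianVector n v) :=
  (memLp_complexGaussian v).comp_measurePreserving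
    (measurePreserving_eval (fun _ => complexGaussian v) i)

lemma integral_eval_gaussianVector (n : ℕ) (v : ℝ) (i : Fin n) :
    ∫ x, x i ∂(gaussianVector n v) = 0 := by
  have hmp : MeasurePreserving (fun x : Fin n → ℂ => x i) (gaussianVector n v)
      (complexGaussian v) := measurePreserving_eval (fun _ => complexGaussian v) i
  rw [← integral_complexGaussian_id v, ← hmp.map_eq, integral_map hmp.aemeasurable]
  exact measurable_id.aestronglyMeasurable

lemma hasCorrelation_gaussianVector (n : ℕ) {v : ℝ} (hv : 0 ≤ v) :
    HasCorrelation (gaussianVector n v) (fun x => x) (fun x => x) ((v : ℂ) • 1) := by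
  have hmp : ∀ i, MeasurePreserving (fun x : Fin n → ℂ => x i) (gaussianVector n v)
      (complexGaussian v) := fun i => measurePreserving_eval (fun _ => complexGaussian v) i
  have hL := memLp_eval_gaussianVector n v
  intro i j
  refine ⟨(hL i).star.integrable_mul (hL j), ?_⟩
  by_cases hij : i = j
  · subst hij
    simp only [Matrix.smul_apply, one_apply_eq, smul_eq_mul, mul_one]
    rw [← integral_star_mul_self_complexGaussian hv, ← (hmp i).map_eq,
      integral_map (hmp i).aemeasurable]
    exact (continuous_star.measurable.mul measurable_id).aestronglyMeasurable
  · have hind : IndepFun (fun x : Fin n → ℂ => star (x i)) (fun x => x j) (gaussianVector n v) := by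
      have h := (iIndepFun_pi (μ := fun _ : Fin n => complexGaussian v) (X := fun _ z => z)
        fun _ => aemeasurable_id).indepFun hij
      exact h.comp continuous_star.measurable measurable_id
    rw [hind.integral_fun_mul_eq_mul_integral (hL i).star.1 (hL j).1, integral_eval_gaussianVector,
      mul_zero]
    simp [one_apply_ne (Ne.symm hij)]

end Moments
end ChannelShortening

namespace ChannelShortening

/-! ### The GMI in closed form and its maximum. -/

section Gmi

open scoped ComplexOrder

variable {nR nT : ℕ}

lemma hasCorrelation_input (N0 : ℝ) :
    HasCorrelation ((gaussianVector nT 1).prod (gaussianVector nR N0)) (fun p => p.1)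
      (fun p => p.1) (1 : Matrix (Fin nT) (Fin nT) ℂ) := by
  intro i j
  have h := hasCorrelation_gaussianVector nT zero_le_one i j
  refine ⟨h.1.comp_fst _, ?_⟩
  rw [integral_fun_fst (fun x : Fin nT → ℂ => star (x i) * x j), h.2]
  simp

lemma hasCorrelation_noise {N0 : ℝ} (hN : 0 ≤ N0) :
    HasCorrelation ((gaussianVector nT 1).prod (gaussianVector nR N0)) (fun p => p.2)
      (fun p => p.2) ((N0 : ℂ) • (1 : Matrix (Fin nR) (Fin nR) ℂ)) := by
  intro i j
  have h := hasCorrelation_gaussianVector nR hN i j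
  refine ⟨h.1.comp_snd _, ?_⟩
  rw [integral_fun_snd (fun x : Fin nR → ℂ => star (x i) * x j), h.2]
  simp

lemma hasCorrelation_input_noise (N0 : ℝ) :
    HasCorrelation ((gaussianVector nT 1).prod (gaussianVector nR N0)) (fun p => p.1)
      (fun p => p.2) (0 : Matrix (Fin nR) (Fin nT) ℂ) := by
  intro i j
  refine ⟨((memLp_eval_gaussianVector nT 1 i).star.integrable one_le_two).mul_prod
    ((memLp_eval_gaussianVector nR N0 j).integrable one_le_two), ?_⟩
  rw [integral_prod_mul (fun x : Fin nT → ℂ => star (x i)) (fun y : Fin nR → ℂ => y j),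
    integral_eval_gaussianVector nR, mul_zero]
  rfl

lemma hasCorrelation_input_output (N0 : ℝ) (H : Matrix (Fin nR) (Fin nT) ℂ) :
    HasCorrelation ((gaussianVector nT 1).prod (gaussianVector nR N0)) (fun p => p.1)
      (fun p => H *ᵥ p.1 + p.2) H := by
  have h := ((hasCorrelation_input (nR := nR) (nT := nT) N0).mulVec H).add
    (hasCorrelation_input_noise N0)
  rwa [Matrix.mul_one, add_zero] at h

lemma hasCorrelation_output {N0 : ℝ} (hN : 0 ≤ N0) (H : Matrix (Fin nR) (Fin nT) ℂ) :
    HasCorrelation ((gaussianVector nT 1).prod (gaussianVector nR N0))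
      (fun p => H *ᵥ p.1 + p.2) (fun p => H *ᵥ p.1 + p.2) (H * Hᴴ + (N0 : ℂ) • 1) := by
  have h1 := (hasCorrelation_input_output N0 H).swap.mulVec H
  have h2 := (((hasCorrelation_input_noise (nR := nR) (nT := nT) N0).swap.mulVec H).add
    (hasCorrelation_noise hN)).swap
  have h := h1.add h2
  simpa using h

lemma gmi_eq {N0 : ℝ} (hN : 0 ≤ N0) (H : Matrix (Fin nR) (Fin nT) ℂ)
    (Hr : Matrix (Fin nT) (Fin nR) ℂ) {Gr : Matrix (Fin nT) (Fin nT) ℂ} (hG : (1 + Gr).PosDef) :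
    gmi N0 H Hr Gr = Real.log (1 + Gr).det.re - Gr.trace.re + 2 * (Hr * H).trace.re
      - ((1 + Gr)⁻¹ * Hr * (H * Hᴴ + (N0 : ℂ) • 1) * Hrᴴ).trace.re := by
  set A := 1 + Gr with hA
  have hd := det_re_pos hG
  have hlogM : ∀ y, Real.log (receiverMarginal Hr Gr y)
      = -Real.log A.det.re + (star y ⬝ᵥ ((Hrᴴ * A⁻¹ * Hr) *ᵥ y)).re := by
    intro y
    rw [receiverMarginal_eq Hr hG, Real.log_mul (inv_pos.mpr hd).ne' (Real.exp_pos _).ne',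
      Real.log_inv, Real.log_exp, star_mulVec, ← dotProduct_mulVec, mulVec_mulVec, mulVec_mulVec,
      Matrix.mul_assoc]
  have hlogR : ∀ x y, Real.log (receiverFn Hr Gr y x)
      = 2 * (star x ⬝ᵥ (Hr *ᵥ y)).re - (star x ⬝ᵥ (Gr *ᵥ x)).re := fun x y => Real.log_exp _
  obtain ⟨i1, e1⟩ := (hasCorrelation_output hN H).quadratic (Hrᴴ * A⁻¹ * Hr)
  obtain ⟨i2, e2⟩ := (hasCorrelation_input_output N0 H).quadratic Hr
  obtain ⟨i3, e3⟩ := (hasCorrelation_input (nR := nR) N0).quadratic Gr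
  simp only [gmi, hlogM, hlogR]
  rw [integral_add (integrable_const _) i1, integral_sub (i2.const_mul 2) i3, integral_const_mul,
    e1, e2, e3, integral_const, probReal_univ, one_smul, Matrix.mul_one]
  have e4 : (Hrᴴ * A⁻¹ * Hr * (H * Hᴴ + (N0 : ℂ) • 1)).trace
      = (A⁻¹ * Hr * (H * Hᴴ + (N0 : ℂ) • 1) * Hrᴴ).trace := by
    rw [trace_mul_comm _ Hrᴴ]
    simp only [Matrix.mul_assoc]
  rw [e4]
  ring

/-- This isolates `Hr` in a single nonnegative trace, leaving the banded log-det problem for `1 +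
Gr`. -/
lemma gmi_eq_sub {N0 : ℝ} (hN : 0 < N0) (H : Matrix (Fin nR) (Fin nT) ℂ)
    (Hr : Matrix (Fin nT) (Fin nR) ℂ) {Gr : Matrix (Fin nT) (Fin nT) ℂ} (hG : (1 + Gr).PosDef) :
    gmi N0 H Hr Gr = Real.log (1 + Gr).det.re
      - ((1 + Gr) * (regularizedGram N0⁻¹ H)⁻¹).trace.re + nT
      - ((1 + Gr)⁻¹ * (Hr - (1 + Gr) * Hᴴ * (H * Hᴴ + (N0 : ℂ) • 1)⁻¹) * (H * Hᴴ + (N0 : ℂ) • 1)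
        * (Hr - (1 + Gr) * Hᴴ * (H * Hᴴ + (N0 : ℂ) • 1)⁻¹)ᴴ).trace.re := by
  have hW : (H * Hᴴ + (N0 : ℂ) • 1).PosDef :=
    PosDef.posSemidef_add (posSemidef_self_mul_conjTranspose H)
      (PosDef.one.smul (by exact_mod_cast hN))
  rw [gmi_eq hN.le H Hr hG, trace_inv_mul_quadratic_sub hG hW, regularizedGram,
    ← one_sub_eq_inv hN, Matrix.mul_sub, Matrix.mul_one, trace_sub, trace_add, trace_one]
  simp only [Complex.sub_re, Complex.add_re, Complex.natCast_re, Fintype.card_fin]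
  ring

lemma isGreatest_csRates (K : ℕ) {N0 : ℝ} (hN : 0 < N0) (H : Matrix (Fin nR) (Fin nT) ℂ) :
    IsGreatest (csRates K N0 H) (bandedValue K (regularizedGram N0⁻¹ H)⁻¹) := by
  have hQ := regularizedGram_posDef (inv_pos.mpr hN).le H
  -- The diagonal always lies in the band, so adding the identity is harmless.
  have hband : ∀ Gr : Matrix (Fin nT) (Fin nT) ℂ, IsBanded K (1 + Gr) ↔ IsBanded K Gr := by
    intro Gr
    refine forall_congr' fun k => forall_congr' fun l => imp_congr_right fun hkl => ?_
    have hne : k ≠ l := by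
      rintro rfl
      simp at hkl
      omega
    rw [Matrix.add_apply, one_apply_ne hne, zero_add]
  constructor
  · obtain ⟨A, hA, hAK, hAv⟩ := exists_log_det_sub_trace_eq_bandedValue K hQ.inv
    have hG : (1 + (A - 1)).PosDef := by rwa [add_sub_cancel]
    refine ⟨A * Hᴴ * (H * Hᴴ + (N0 : ℂ) • 1)⁻¹, A - 1,
      ⟨hA.1.sub isHermitian_one, ?_, fun y => integrable_receiverFn _ hG y⟩, ?_⟩
    · rwa [← IsBanded, ← hband, add_sub_cancel]
    · rw [gmi_eq_sub hN H _ hG, add_sub_cancel, sub_self, hAv]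
      simp
  · rintro r ⟨Hr, Gr, hcs, rfl⟩
    have hG := posDef_one_add_of_isCSReceiver hcs
    have hW : (H * Hᴴ + (N0 : ℂ) • 1).PosDef :=
      PosDef.posSemidef_add (posSemidef_self_mul_conjTranspose H)
        (PosDef.one.smul (by exact_mod_cast hN))
    have h1 := log_det_sub_trace_le_bandedValue K hG ((hband Gr).2 hcs.banded) hQ.inv
    have h2 := trace_inv_mul_quadratic_nonneg hG hW
      (Hr - (1 + Gr) * Hᴴ * (H * Hᴴ + (N0 : ℂ) • 1)⁻¹)
    rw [gmi_eq_sub hN H Hr hG]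
    linarith

lemma csRate_eq (K : ℕ) {N0 : ℝ} (hN : 0 < N0) (H : Matrix (Fin nR) (Fin nT) ℂ) :
    csRate K N0 H = ∑ i, (Real.log (minorDet (regularizedGram N0⁻¹ H) fun j =>
        ¬(Window K i j ∧ j ≠ i))
      - Real.log (minorDet (regularizedGram N0⁻¹ H) fun j => ¬Window K i j)) := by
  rw [csRate, (isGreatest_csRates K hN H).csSup_eq,
    bandedValue_inv_eq K (regularizedGram_posDef (inv_pos.mpr hN).le H)]

end Gmi
end ChannelShortening

namespace ChannelShortening

/-! ### Submatrices of a Gaussian matrix are Gaussian. -/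

section Reindex

lemma measurePreserving_pi_comp {ι κ α : Type*} [Fintype ι] [Fintype κ] [MeasurableSpace α]
    (μ : Measure α) [IsProbabilityMeasure μ] {e : κ → ι} (he : Function.Injective e) :
    MeasurePreserving (fun (x : ι → α) j => x (e j)) (Measure.pi fun _ => μ)
      (Measure.pi fun _ => μ) := by
  have hm : Measurable fun (x : ι → α) j => x (e j) :=
    measurable_pi_lambda _ fun j => measurable_pi_apply (e j)
  refine ⟨hm, ?_⟩
  have h := (iIndepFun_pi (μ := fun _ : ι => μ) (X := fun _ z => z)
    fun _ => aemeasurable_id).precomp he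
  rw [iIndepFun_iff_map_fun_eq_pi_map fun j => (measurable_pi_apply (e j)).aemeasurable] at h
  rw [h]
  congr 1
  ext1 j
  exact (measurePreserving_eval (fun _ : ι => μ) (e j)).map_eq

lemma measurePreserving_columns {nR n m : ℕ} {e : Fin m → Fin n} (he : Function.Injective e) :
    MeasurePreserving (fun (H : Fin nR → Fin n → ℂ) i j => H i (e j)) (channelLaw nR n)
      (channelLaw nR m) :=
  measurePreserving_pi _ _ fun _ => measurePreserving_pi_comp _ he

lemma measurePreserving_rows {nR n m : ℕ} {e : Fin m → Fin nR} (he : Function.Injective e) :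
    MeasurePreserving (fun (H : Fin nR → Fin n → ℂ) i => H (e i)) (channelLaw nR n)
      (channelLaw m n) :=
  measurePreserving_pi_comp _ he

end Reindex

/-! ### Inverse moments of Gaussian determinants. -/

section InverseMoment

open scoped ENNReal

lemma lintegral_ball_enorm_inv_lt_top :
    ∫⁻ z in Metric.ball (0 : ℂ) 1, ‖z‖ₑ⁻¹ < ∞ := by
  have h : IntegrableOn (fun z : ℂ => ‖z‖⁻¹) (Metric.ball 0 1) := by
    refine integrableOn_ball_of_norm_le_rpow (C := 1) (α := 1) ?_ ?_ (ae_of_all _ fun z => ?_)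
      (by fun_prop)
    · rw [Complex.finrank_real_complex]; norm_num
    · rw [Complex.finrank_real_complex]; norm_num
    · rw [Real.rpow_neg_one]; simp
  have h2 := h.2
  rw [hasFiniteIntegral_iff_enorm] at h2
  refine lt_of_eq_of_lt (lintegral_congr_ae ?_) h2
  have h0 : ∀ᵐ z : ℂ ∂(volume.restrict (Metric.ball 0 1)), z ≠ 0 :=
    ae_restrict_of_ae (Measure.ae_ne volume 0)
  filter_upwards [h0] with z hz
  rw [enorm_inv (norm_ne_zero_iff.mpr hz), enorm_norm]

lemma complexGaussian_one_le_volume : complexGaussian 1 ≤ volume := by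
  rw [complexGaussian_one_eq_withDensity]
  conv_rhs => rw [← withDensity_one (μ := (volume : Measure ℂ))]
  refine withDensity_mono (ae_of_all _ fun z => ?_)
  rw [Pi.one_apply, ENNReal.ofReal_le_one]
  have h1 : Real.pi⁻¹ ≤ 1 := inv_le_one_of_one_le₀ (by linarith [Real.pi_gt_three])
  have h2 : Real.exp (-‖z‖ ^ 2) ≤ 1 := Real.exp_le_one_iff.mpr (by nlinarith [sq_nonneg ‖z‖])
  exact mul_le_one₀ h1 (Real.exp_pos _).le h2

/-- A bound for the first inverse moment of a complex Gaussian variable with any mean. -/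
noncomputable def inverseMomentBound : ℝ≥0∞ := (∫⁻ z in Metric.ball (0 : ℂ) 1, ‖z‖ₑ⁻¹) + 1

lemma inverseMomentBound_lt_top : inverseMomentBound < ∞ :=
  ENNReal.add_lt_top.mpr ⟨lintegral_ball_enorm_inv_lt_top, ENNReal.one_lt_top⟩

lemma inverseMomentBound_ne_zero : inverseMomentBound ≠ 0 := by
  simp [inverseMomentBound]

/-- Uniformity in `w` comes from a density at most `1` and translation invariance of Lebesgue
measure: `‖z‖⁻¹` is integrable near `0` in real dimension two, and at most `1` outside the unit
ball. -/
lemma lintegral_enorm_add_inv_le (w : ℂ) :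
    ∫⁻ z, ‖z + w‖ₑ⁻¹ ∂(complexGaussian 1) ≤ inverseMomentBound := by
  set f : ℂ → ℝ≥0∞ := (Metric.ball (0 : ℂ) 1).indicator fun z => ‖z‖ₑ⁻¹ with hf
  have hfm : Measurable f := (measurable_enorm.inv).indicator Metric.isOpen_ball.measurableSet
  have hle : ∀ z : ℂ, ‖z‖ₑ⁻¹ ≤ f z + 1 := by
    intro z
    by_cases hz : z ∈ Metric.ball (0 : ℂ) 1
    · rw [hf, Set.indicator_of_mem hz]
      exact le_self_add
    · refine le_trans ?_ le_add_self
      rw [ENNReal.inv_le_one, ← ofReal_norm, ← ENNReal.ofReal_one]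
      refine ENNReal.ofReal_le_ofReal ?_
      simpa using hz
  calc ∫⁻ z, ‖z + w‖ₑ⁻¹ ∂(complexGaussian 1)
      ≤ ∫⁻ z, (f (z + w) + 1) ∂(complexGaussian 1) := lintegral_mono fun z => hle (z + w)
    _ = (∫⁻ z, f (z + w) ∂(complexGaussian 1)) + 1 := by
        rw [lintegral_add_right _ measurable_const]; simp
    _ ≤ (∫⁻ z, f (z + w)) + 1 :=
        add_le_add_left (lintegral_mono' complexGaussian_one_le_volume le_rfl) 1
    _ = inverseMomentBound := by
        rw [lintegral_add_right_eq_self f w, hf,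
          lintegral_indicator Metric.isOpen_ball.measurableSet, inverseMomentBound]

lemma lintegral_enorm_mul_add_inv_le (a b : ℂ) :
    ∫⁻ z, ‖z * a + b‖ₑ⁻¹ ∂(complexGaussian 1) ≤ inverseMomentBound * ‖a‖ₑ⁻¹ := by
  by_cases ha : a = 0
  -- In `ℝ≥0∞` the inverse of `0` is `∞`, so the bound is trivial here.
  · rw [ha, enorm_zero, ENNReal.inv_zero, ENNReal.mul_top inverseMomentBound_ne_zero]
    exact le_top
  · have h : ∀ z : ℂ, ‖z * a + b‖ₑ⁻¹ = ‖z + b / a‖ₑ⁻¹ * ‖a‖ₑ⁻¹ := by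
      intro z
      rw [← ENNReal.mul_inv (Or.inr enorm_ne_top) (Or.inl enorm_ne_top), ← enorm_mul, add_mul,
        div_mul_cancel₀ _ ha]
    simp only [h]
    rw [lintegral_mul_const _ (by fun_prop)]
    gcongr
    exact lintegral_enorm_add_inv_le _

lemma measurable_det_of_apply {Ω ι : Type*} [MeasurableSpace Ω] [Fintype ι] [DecidableEq ι]
    {M : Ω → Matrix ι ι ℂ} (h : ∀ i j, Measurable fun o => M o i j) :
    Measurable fun o => (M o).det := by
  simp only [det_apply]
  exact Finset.measurable_fun_sum _ fun σ _ =>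
    (Finset.measurable_fun_prod _ fun i _ => h (σ i) i).const_smul _

lemma measurable_entry {m n : ℕ} (i : Fin m) (j : Fin n) :
    Measurable fun H : Fin m → Fin n → ℂ => H i j :=
  (measurable_pi_apply j).comp (measurable_pi_apply i)

lemma measurable_det {n : ℕ} : Measurable fun H : Fin n → Fin n → ℂ => (Matrix.of H).det :=
  measurable_det_of_apply measurable_entry

/-- Only the coordinate `r 0` is integrated against its density; the others act as a fixed shift. -/
lemma lintegral_gaussianVector_linear_inv_le {n : ℕ} (c : Fin (n + 1) → ℂ) :
    ∫⁻ r, ‖∑ j, r j * c j‖ₑ⁻¹ ∂(gaussianVector (n + 1) 1) ≤ inverseMomentBound * ‖c 0‖ₑ⁻¹ := by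
  have h := (measurePreserving_piFinSuccAbove (fun _ : Fin (n + 1) => complexGaussian 1) 0).symm
  have hm : Measurable fun r : Fin (n + 1) → ℂ => ‖∑ j, r j * c j‖ₑ⁻¹ :=
    (Finset.measurable_fun_sum _ fun j _ =>
      Measurable.mul_const (f := fun r : Fin (n + 1) → ℂ => r j) (measurable_pi_apply j)
        (c j)).enorm.inv
  rw [gaussianVector, ← h.lintegral_comp_emb (MeasurableEquiv.measurableEmbedding _),
    lintegral_prod_symm]
  swap
  · exact (hm.comp (MeasurableEquiv.measurable _)).aemeasurable
  simp only [MeasurableEquiv.piFinSuccAbove_symm_apply, Fin.insertNthEquiv_apply,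
    Fin.sum_univ_succ, Fin.insertNth_zero', Fin.cons_zero, Fin.cons_succ]
  calc _ ≤ ∫⁻ _ : Fin n → ℂ, inverseMomentBound * ‖c 0‖ₑ⁻¹
        ∂(Measure.pi fun _ => complexGaussian 1) :=
      lintegral_mono fun y => lintegral_enorm_mul_add_inv_le _ _
    _ = _ := by simp

/-- The determinant of a square Gaussian matrix has a finite inverse moment. -/
lemma lintegral_enorm_det_inv_le (n : ℕ) :
    ∫⁻ H, ‖(Matrix.of H).det‖ₑ⁻¹ ∂(channelLaw n n) ≤ inverseMomentBound ^ n := by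
  induction n with
  | zero => simp
  | succ n ih =>
    have h := (measurePreserving_piFinSuccAbove
      (fun _ : Fin (n + 1) => gaussianVector (n + 1) 1) 0).symm
    have hcol := measurePreserving_columns (nR := n) (Fin.succ_injective n)
    have hlaw : channelLaw (n + 1) (n + 1)
      = Measure.pi fun _ : Fin (n + 1) => gaussianVector (n + 1) 1 := rfl
    rw [hlaw, ← h.lintegral_comp_emb (MeasurableEquiv.measurableEmbedding _), lintegral_prod_symm]
    · calc _ ≤ ∫⁻ R : Fin n → Fin (n + 1) → ℂ, inverseMomentBound
              * ‖(Matrix.of fun i j => R i (Fin.succ j)).det‖ₑ⁻¹ ∂(channelLaw n (n + 1)) := by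
            refine lintegral_mono fun R => ?_
            have hdet : ∀ r : Fin (n + 1) → ℂ,
                (Matrix.of ((MeasurableEquiv.piFinSuccAbove
                  (fun _ : Fin (n + 1) => Fin (n + 1) → ℂ) 0).symm (r, R))).det
                = ∑ j, r j * ((-1) ^ (j : ℕ)
                  * (Matrix.of fun i k => R i (j.succAbove k)).det) := by
              intro r
              rw [det_succ_row_zero]
              refine Finset.sum_congr rfl fun j _ => ?_
              simp only [MeasurableEquiv.piFinSuccAbove_symm_apply, Fin.insertNthEquiv_apply,
                Fin.insertNth_zero', of_apply, Fin.cons_zero]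
              have : (Matrix.of ((Fin.insertNthEquiv (fun _ => Fin (n + 1) → ℂ) 0) (r, R))
                  ).submatrix Fin.succ j.succAbove = Matrix.of fun i k => R i (j.succAbove k) := by
                ext i k; simp
              rw [this]
              ring
            simp only [hdet]
            -- Given the other rows, the determinant is linear in the first row. Its coefficient at
            -- `r 0` is a square Gaussian determinant of size `n`, to which the induction applies.
            refine (lintegral_gaussianVector_linear_inv_le _).trans (le_of_eq ?_)
            simp
        _ = inverseMomentBound * ∫⁻ H, ‖(Matrix.of H).det‖ₑ⁻¹ ∂(channelLaw n n) := by
            have hm : Measurable fun H : Fin n → Fin n → ℂ => ‖(Matrix.of H).det‖ₑ⁻¹ :=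
              measurable_det.enorm.inv
            rw [← hcol.lintegral_comp hm]
            exact lintegral_const_mul _ (hm.comp hcol.measurable)
        _ ≤ inverseMomentBound ^ (n + 1) := by
            rw [pow_succ']
            gcongr
    · exact (measurable_det.comp (MeasurableEquiv.measurable _)).enorm.inv.aemeasurable

end InverseMoment
end ChannelShortening

namespace ChannelShortening

/-! ### Bounds and limits for `log det (1 + t G)`. -/

section Gram

open scoped ComplexOrder

lemma sq_norm_det_submatrix_le {ι κ : Type*} [Fintype ι] [DecidableEq ι] [Fintype κ]
    [DecidableEq κ] (Z : Matrix κ ι ℂ) {e : ι → κ} (he : Function.Injective e) :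
    ‖(Z.submatrix e id).det‖ ^ 2 ≤ (Zᴴ * Z).det.re := by
  set Y := Z.submatrix e id
  -- `Z'` keeps the rows not selected by `e`; its Gram matrix is the positive semidefinite
  -- remainder.
  set Z' : Matrix κ ι ℂ := of fun k j => if k ∈ Finset.univ.image e then 0 else Z k j with hZ'
  have hsplit : Zᴴ * Z = Yᴴ * Y + Z'ᴴ * Z' := by
    ext i j
    have h1 : ∑ a, star (Z (e a) i) * Z (e a) j
        = ∑ k ∈ Finset.univ.image e, star (Z k i) * Z k j :=
      (Finset.sum_image (f := fun k => star (Z k i) * Z k j) he.injOn).symm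
    have h2 : ∀ k, star (Z' k i) * Z' k j
        = if k ∈ Finset.univ.image e then 0 else star (Z k i) * Z k j := by
      intro k
      simp only [hZ', of_apply]
      split_ifs <;> simp
    simp only [Matrix.add_apply, mul_apply, conjTranspose_apply, h2]
    change _ = ∑ a, star (Z (e a) i) * Z (e a) j + _
    rw [h1, ← Finset.sum_add_sum_compl (Finset.univ.image e)]
    congr 1
    rw [← Finset.sum_add_sum_compl (Finset.univ.image e)
      (fun k => if k ∈ Finset.univ.image e then 0 else star (Z k i) * Z k j),
      Finset.sum_eq_zero (s := Finset.univ.image e) fun k hk => if_pos hk, zero_add]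
    exact Finset.sum_congr rfl fun k hk => (if_neg (Finset.mem_compl.mp hk)).symm
  have hdet : (Yᴴ * Y).det.re = ‖Y.det‖ ^ 2 := by
    rw [det_mul, det_conjTranspose, Complex.star_def, ← Complex.normSq_eq_conj_mul_self,
      Complex.ofReal_re, Complex.normSq_eq_norm_sq]
  rw [hsplit, ← hdet]
  exact det_re_mono (posSemidef_conjTranspose_mul_self Y) (posSemidef_conjTranspose_mul_self Z')

/-- The determinant of the leading square submatrix of maximal size. -/
noncomputable def leadingDet {nR n : ℕ} (H : Matrix (Fin nR) (Fin n) ℂ) : ℂ :=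
  if h : nR < n then (H.submatrix id (Fin.castLE h.le)).det
  else (H.submatrix (Fin.castLE (not_lt.mp h)) id).det

lemma det_regularizedGram_conjTranspose {nR n : ℕ} (t : ℝ) (H : Matrix (Fin nR) (Fin n) ℂ) :
    (1 + (t : ℂ) • (H * Hᴴ)).det = (regularizedGram t H).det := by
  rw [regularizedGram, ← Matrix.smul_mul, det_one_add_mul_comm, Matrix.mul_smul]

/-- The smaller Gram matrix of `H`. -/
lemma exists_gram {nR n : ℕ} (H : Matrix (Fin nR) (Fin n) ℂ) :
    ∃ (k : ℕ) (G : Matrix (Fin k) (Fin k) ℂ), k = min nR n ∧ G.PosSemidef ∧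
      logDetGram H = Real.log G.det.re ∧ ‖leadingDet H‖ ^ 2 ≤ G.det.re ∧
      ∀ t : ℝ, (regularizedGram t H).det = (1 + (t : ℂ) • G).det := by
  by_cases h : nR < n
  · refine ⟨nR, H * Hᴴ, (min_eq_left h.le).symm, posSemidef_self_mul_conjTranspose H,
      by rw [logDetGram, if_pos h], ?_, fun t => (det_regularizedGram_conjTranspose t H).symm⟩
    have h1 := sq_norm_det_submatrix_le Hᴴ (Fin.castLE_injective h.le)
    rw [conjTranspose_conjTranspose] at h1
    rw [leadingDet, dif_pos h]
    refine le_trans (le_of_eq ?_) h1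
    rw [← norm_star (Matrix.det _), ← det_conjTranspose]
    rfl
  · refine ⟨n, Hᴴ * H, (min_eq_right (not_lt.mp h)).symm, posSemidef_conjTranspose_mul_self H,
      by rw [logDetGram, if_neg h], ?_, fun t => rfl⟩
    rw [leadingDet, dif_neg h]
    exact sq_norm_det_submatrix_le H (Fin.castLE_injective _)

variable {k : ℕ} {G : Matrix (Fin k) (Fin k) ℂ}

/-- Factoring `t` out of a `k × k` determinant turns the limit `t → ∞` into a vanishing
regularization `t⁻¹`. -/
lemma log_det_one_add_smul_sub {t : ℝ} (ht : 0 < t) (hG : G.PosSemidef) :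
    Real.log (1 + (t : ℂ) • G).det.re - k * Real.log t
      = Real.log (G + ((t⁻¹ : ℝ) : ℂ) • 1).det.re := by
  have ht' : (t : ℂ) ≠ 0 := by exact_mod_cast ht.ne'
  have hpd : (G + ((t⁻¹ : ℝ) : ℂ) • 1).PosDef :=
    PosDef.posSemidef_add hG (PosDef.one.smul (by exact_mod_cast inv_pos.mpr ht))
  have h : 1 + (t : ℂ) • G = (t : ℂ) • (G + ((t⁻¹ : ℝ) : ℂ) • 1) := by
    rw [smul_add, smul_smul]
    push_cast
    rw [mul_inv_cancel₀ ht', one_smul, add_comm]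
  rw [h, det_smul, Fintype.card_fin, ← Complex.ofReal_pow, Complex.re_ofReal_mul,
    Real.log_mul (by positivity) (det_re_pos hpd).ne', Real.log_pow]
  ring

lemma log_det_le_log_det_one_add_smul_sub {t : ℝ} (ht : 0 < t) (hG : G.PosSemidef)
    (hdet : 0 < G.det.re) :
    Real.log G.det.re ≤ Real.log (1 + (t : ℂ) • G).det.re - k * Real.log t := by
  rw [log_det_one_add_smul_sub ht hG]
  exact Real.log_le_log hdet
    (det_re_mono hG (PosSemidef.one.smul (by exact_mod_cast (inv_pos.mpr ht).le)))

lemma log_det_one_add_smul_sub_le {t : ℝ} (ht : 1 ≤ t) (hG : G.PosSemidef) :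
    Real.log (1 + (t : ℂ) • G).det.re - k * Real.log t ≤ Real.log (1 + G).det.re := by
  have ht0 : 0 < t := one_pos.trans_le ht
  rw [log_det_one_add_smul_sub ht0 hG]
  have hpd : (G + ((t⁻¹ : ℝ) : ℂ) • 1).PosDef :=
    PosDef.posSemidef_add hG (PosDef.one.smul (by exact_mod_cast inv_pos.mpr ht0))
  refine Real.log_le_log (det_re_pos hpd) ?_
  have h : 1 + G = (G + ((t⁻¹ : ℝ) : ℂ) • 1) + ((1 - t⁻¹ : ℝ) : ℂ) • 1 := by
    rw [add_assoc, ← add_smul]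
    push_cast
    rw [add_sub_cancel, one_smul, add_comm]
  rw [h]
  refine det_re_mono hpd.posSemidef (PosSemidef.one.smul ?_)
  exact_mod_cast sub_nonneg.mpr (inv_le_one_of_one_le₀ ht)

lemma tendsto_log_det_one_add_smul_sub (hG : G.PosSemidef) (hdet : 0 < G.det.re) :
    Tendsto (fun t : ℝ => Real.log (1 + (t : ℂ) • G).det.re - k * Real.log t) atTop
      (𝓝 (Real.log G.det.re)) := by
  have h1 : Tendsto (fun s : ℝ => Real.log (G + (s : ℂ) • 1).det.re) (𝓝 0)
      (𝓝 (Real.log (G + ((0 : ℝ) : ℂ) • 1).det.re)) := by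
    have hc : Continuous fun s : ℝ => (G + (s : ℂ) • (1 : Matrix (Fin k) (Fin k) ℂ)).det.re := by
      refine Complex.continuous_re.comp (Continuous.matrix_det ?_)
      exact continuous_const.add (Complex.continuous_ofReal.smul continuous_const)
    refine (hc.tendsto 0).log ?_
    simpa using hdet.ne'
  simp only [Complex.ofReal_zero, zero_smul, add_zero] at h1
  refine (h1.comp tendsto_inv_atTop_zero).congr' ?_
  filter_upwards [eventually_gt_atTop 0] with t ht
  exact (log_det_one_add_smul_sub ht hG).symm

end Gram

/-! ### Integrability and the high-SNR limit of the ergodic log-determinant. -/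

section Expectation

open scoped ENNReal ComplexOrder

variable {nR n : ℕ}

lemma measurable_regularizedGram_apply (t : ℝ) (i j : Fin n) :
    Measurable fun H : Fin nR → Fin n → ℂ => regularizedGram t (Matrix.of H) i j := by
  simp only [regularizedGram, Matrix.add_apply, Matrix.smul_apply, mul_apply, conjTranspose_apply,
    of_apply]
  have h : Measurable fun H : Fin nR → Fin n → ℂ => ∑ k, star (H k i) * H k j :=
    Finset.measurable_fun_sum _ fun k _ =>
      (continuous_star.measurable.comp (measurable_entry k i)).mul (measurable_entry k j)
  exact measurable_const.add (h.const_smul (t : ℂ))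

lemma measurable_log_det_regularizedGram (t : ℝ) :
    Measurable fun H : Fin nR → Fin n → ℂ => Real.log (regularizedGram t (Matrix.of H)).det.re :=
  Real.measurable_log.comp (Complex.measurable_re.comp
    (measurable_det_of_apply (measurable_regularizedGram_apply t)))

lemma measurable_logDetGram :
    Measurable fun H : Fin nR → Fin n → ℂ => logDetGram (Matrix.of H) := by
  unfold logDetGram
  split_ifs
  · refine Real.measurable_log.comp (Complex.measurable_re.comp
      (measurable_det_of_apply fun i j => ?_))
    simp only [mul_apply, conjTranspose_apply, of_apply]
    exact Finset.measurable_fun_sum _ fun k _ =>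
      (measurable_entry i k).mul (continuous_star.measurable.comp (measurable_entry j k))
  · refine Real.measurable_log.comp (Complex.measurable_re.comp
      (measurable_det_of_apply fun i j => ?_))
    simp only [mul_apply, conjTranspose_apply, of_apply]
    exact Finset.measurable_fun_sum _ fun k _ =>
      (continuous_star.measurable.comp (measurable_entry k i)).mul (measurable_entry k j)

lemma integrable_sum_sq_norm :
    Integrable (fun H : Fin nR → Fin n → ℂ => ∑ i, ∑ j, ‖H i j‖ ^ 2) (channelLaw nR n) := by
  refine integrable_finsetSum _ fun i _ => integrable_finsetSum _ fun j _ => ?_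
  have h : MeasurePreserving (fun H : Fin nR → Fin n → ℂ => H i j) (channelLaw nR n)
      (complexGaussian 1) :=
    (measurePreserving_eval (fun _ : Fin n => complexGaussian 1) j).comp
      (measurePreserving_eval (fun _ : Fin nR => Measure.pi fun _ : Fin n => complexGaussian 1) i)
  exact ((memLp_complexGaussian 1).comp_measurePreserving h).integrable_norm_pow two_ne_zero

lemma integrable_log_det_regularizedGram {t : ℝ} (ht : 0 ≤ t) :
    Integrable (fun H : Fin nR → Fin n → ℂ => Real.log (regularizedGram t (Matrix.of H)).det.re)
      (channelLaw nR n) := by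
  refine ((integrable_sum_sq_norm (nR := nR) (n := n)).const_mul t).mono'
    (measurable_log_det_regularizedGram t).aestronglyMeasurable (ae_of_all _ fun H => ?_)
  rw [Real.norm_of_nonneg (log_det_regularizedGram_nonneg ht _)]
  exact log_det_regularizedGram_le ht (Matrix.of H)

lemma measurable_leadingDet :
    Measurable fun H : Fin nR → Fin n → ℂ => leadingDet (Matrix.of H) := by
  unfold leadingDet
  split_ifs
  · exact measurable_det_of_apply fun i j => measurable_entry _ _
  · exact measurable_det_of_apply fun i j => measurable_entry _ _

lemma lintegral_enorm_leadingDet_inv_lt_top :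
    ∫⁻ H : Fin nR → Fin n → ℂ, ‖leadingDet (Matrix.of H)‖ₑ⁻¹ ∂(channelLaw nR n) < ∞ := by
  have hlt : ∀ m : ℕ, ∫⁻ H, ‖(Matrix.of H).det‖ₑ⁻¹ ∂(channelLaw m m) < ∞ := fun m =>
    (lintegral_enorm_det_inv_le m).trans_lt (ENNReal.pow_lt_top inverseMomentBound_lt_top)
  have hm : ∀ m : ℕ, Measurable fun H : Fin m → Fin m → ℂ => ‖(Matrix.of H).det‖ₑ⁻¹ := fun m =>
    measurable_det.enorm.inv
  unfold leadingDet
  split_ifs with h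
  · have hp := measurePreserving_columns (nR := nR) (Fin.castLE_injective h.le)
    have := hlt nR
    rwa [← hp.lintegral_comp (hm nR)] at this
  · have hp := measurePreserving_rows (n := n) (Fin.castLE_injective (not_lt.mp h))
    have := hlt n
    rwa [← hp.lintegral_comp (hm n)] at this

lemma ae_leadingDet_ne_zero :
    ∀ᵐ H : Fin nR → Fin n → ℂ ∂(channelLaw nR n), leadingDet (Matrix.of H) ≠ 0 := by
  have h := ae_lt_top (measurable_leadingDet (nR := nR) (n := n)).enorm.inv
    lintegral_enorm_leadingDet_inv_lt_top.ne
  filter_upwards [h] with H hH h0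
  simp [h0] at hH

lemma integrable_norm_leadingDet_inv :
    Integrable (fun H : Fin nR → Fin n → ℂ => ‖leadingDet (Matrix.of H)‖⁻¹) (channelLaw nR n) := by
  refine ⟨measurable_leadingDet.norm.inv.aestronglyMeasurable, ?_⟩
  rw [hasFiniteIntegral_iff_enorm]
  refine lt_of_eq_of_lt (lintegral_congr_ae ?_) (lintegral_enorm_leadingDet_inv_lt_top (nR := nR))
  filter_upwards [ae_leadingDet_ne_zero] with H hH
  rw [enorm_inv (norm_ne_zero_iff.mpr hH), enorm_norm]

/-- Almost surely `logDetGram H` lies between `2 log ‖leadingDet H‖` and the logarithm of the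
regularized determinant at `t = 1`. The elementary bound `1 - x⁻¹ ≤ log x` makes the lower side
integrable through the inverse moment. -/
lemma integrable_logDetGram :
    Integrable (fun H : Fin nR → Fin n → ℂ => logDetGram (Matrix.of H)) (channelLaw nR n) := by
  refine ((integrable_log_det_regularizedGram zero_le_one).add
    (integrable_norm_leadingDet_inv.const_mul 2)).mono'
    measurable_logDetGram.aestronglyMeasurable ?_
  filter_upwards [ae_leadingDet_ne_zero] with H hH
  obtain ⟨k, G, -, hG, hlog, hlead, hreg⟩ := exists_gram (Matrix.of H)
  have hpos : 0 < ‖leadingDet (Matrix.of H)‖ := norm_pos_iff.mpr hH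
  have hdet : 0 < G.det.re := (pow_pos hpos 2).trans_le hlead
  have h1 := log_det_le_log_det_one_add_smul_sub one_pos hG hdet
  have h2 := Real.log_le_log (pow_pos hpos 2) hlead
  have h3 := Real.one_sub_inv_le_log_of_pos hpos
  have h4 := log_det_regularizedGram_nonneg zero_le_one (Matrix.of H)
  have h5 : 0 < ‖leadingDet (Matrix.of H)‖⁻¹ := inv_pos.mpr hpos
  rw [Real.log_pow] at h2
  rw [Real.log_one, mul_zero, sub_zero, ← hreg] at h1
  push_cast at h2
  simp only [Pi.add_apply]
  rw [hlog, Real.norm_eq_abs, abs_le]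
  constructor <;> linarith

/-- The ergodic `log det` of the regularized Gram matrix. -/
noncomputable def ergodicLogDet (nR n : ℕ) (t : ℝ) : ℝ :=
  ∫ H, Real.log (regularizedGram t (Matrix.of H)).det.re ∂(channelLaw nR n)

lemma tendsto_ergodicLogDet_sub (nR n : ℕ) :
    Tendsto (fun t => ergodicLogDet nR n t - (min nR n : ℕ) * Real.log t) atTop
      (𝓝 (wishartJ nR n)) := by
  have h : Tendsto (fun t : ℝ => ∫ H : Fin nR → Fin n → ℂ,
      (Real.log (regularizedGram t (Matrix.of H)).det.re - (min nR n : ℕ) * Real.log t)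
      ∂(channelLaw nR n)) atTop (𝓝 (wishartJ nR n)) := by
    -- For `t ≥ 1` the integrand lies between `log det G` and `log det (1 + G)`, where `G` is the
    -- smaller Gram matrix; both are integrable and free of `t`.
    refine tendsto_integral_filter_of_dominated_convergence
      (fun H => Real.log (regularizedGram 1 (Matrix.of H)).det.re + |logDetGram (Matrix.of H)|)
      (Eventually.of_forall fun t =>
        ((measurable_log_det_regularizedGram t).sub_const _).aestronglyMeasurable) ?_
      ((integrable_log_det_regularizedGram zero_le_one).add integrable_logDetGram.abs) ?_
    · filter_upwards [eventually_ge_atTop 1] with t ht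
      filter_upwards [ae_leadingDet_ne_zero] with H hH
      obtain ⟨k, G, rfl, hG, hlog, hlead, hreg⟩ := exists_gram (Matrix.of H)
      have hdet : 0 < G.det.re := (pow_pos (norm_pos_iff.mpr hH) 2).trans_le hlead
      have h1 := log_det_le_log_det_one_add_smul_sub (one_pos.trans_le ht) hG hdet
      have h2 := log_det_one_add_smul_sub_le ht hG
      have h3 := log_det_regularizedGram_nonneg zero_le_one (Matrix.of H)
      have h4 := neg_abs_le (logDetGram (Matrix.of H))
      have h5 := abs_nonneg (logDetGram (Matrix.of H))
      have h6 := hreg 1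
      rw [Complex.ofReal_one, one_smul] at h6
      rw [← h6] at h2
      rw [← hlog] at h1
      rw [hreg t, Real.norm_eq_abs, abs_le]
      constructor <;> linarith
    · filter_upwards [ae_leadingDet_ne_zero] with H hH
      obtain ⟨k, G, rfl, hG, hlog, hlead, hreg⟩ := exists_gram (Matrix.of H)
      have hdet : 0 < G.det.re := (pow_pos (norm_pos_iff.mpr hH) 2).trans_le hlead
      simp only [hlog, hreg]
      exact tendsto_log_det_one_add_smul_sub hG hdet
  refine h.congr' ?_
  filter_upwards [eventually_ge_atTop 0] with t ht
  rw [integral_sub (integrable_log_det_regularizedGram ht) (integrable_const _), integral_const,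
    probReal_univ, one_smul, ergodicLogDet]

end Expectation
end ChannelShortening

namespace ChannelShortening

/-! ### The ergodic rate and its affine expansion in `log snr`. -/

section Rate

variable {nR n : ℕ}

/-- Any selection of columns has the law of a smaller channel matrix, so the mean depends on `p`
only through its cardinality. -/
lemma integrable_and_integral_log_minorDet {t : ℝ} (ht : 0 ≤ t) (p : Fin n → Prop)
    [DecidablePred p] :
    Integrable (fun H : Fin nR → Fin n → ℂ =>
        Real.log (minorDet (regularizedGram t (Matrix.of H)) p)) (channelLaw nR n) ∧
      ∫ H, Real.log (minorDet (regularizedGram t (Matrix.of H)) p) ∂(channelLaw nR n)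
        = ergodicLogDet nR (Fintype.card {j // p j}) t := by
  set e := (Fintype.equivFin {j // p j}).symm
  have hp := measurePreserving_columns (nR := nR) (e := fun j => (e j : Fin n))
    (Subtype.val_injective.comp e.injective)
  have hmin : (fun H : Fin nR → Fin n → ℂ =>
      Real.log (minorDet (regularizedGram t (Matrix.of H)) p)) = fun H => Real.log
        (regularizedGram t (Matrix.of fun i j => H i (e j))).det.re := by
    ext H
    rw [minorDet_regularizedGram t (Matrix.of H) p e]
    rfl
  rw [hmin]
  refine ⟨hp.integrable_comp_of_integrable (integrable_log_det_regularizedGram ht), ?_⟩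
  rw [ergodicLogDet, ← hp.map_eq, integral_map hp.measurable.aemeasurable
    (measurable_log_det_regularizedGram t).aestronglyMeasurable]

/-- There are `i` indices before the window; the truncated subtraction counts those after it and is
`0` when the window overruns the end. -/
lemma card_not_window (K : ℕ) (i : Fin n) :
    Fintype.card {j // ¬Window K i j} = i + (n - (i + K + 1)) := by
  rw [Fintype.card_subtype, Finset.card_filter]
  have h := Fin.sum_univ_eq_sum_range
    (fun j => if ¬((i : ℕ) ≤ j ∧ j ≤ i + K) then 1 else 0) n
  refine h.trans ?_
  rw [← Finset.card_filter]
  have h2 : (Finset.range n).filter (fun j => ¬((i : ℕ) ≤ j ∧ j ≤ i + K))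
      = Finset.range i ∪ Finset.Ico (i + K + 1) n := by
    ext j
    have := i.2
    simp only [Finset.mem_filter, Finset.mem_range, Finset.mem_union, Finset.mem_Ico]
    omega
  rw [h2, Finset.card_union_of_disjoint, Finset.card_range, Nat.card_Ico]
  rw [Finset.disjoint_left]
  intro j hj
  simp only [Finset.mem_range, Finset.mem_Ico] at hj ⊢
  omega

lemma card_not_window_erase (K : ℕ) (i : Fin n) :
    Fintype.card {j // ¬(Window K i j ∧ j ≠ i)} = i + (n - (i + K + 1)) + 1 := by
  rw [← card_not_window K i, Fintype.card_subtype, Fintype.card_subtype]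
  have h : (Finset.univ.filter fun j => ¬(Window K i j ∧ j ≠ i))
      = insert i (Finset.univ.filter fun j => ¬Window K i j) := by
    ext j
    simp only [Finset.mem_filter, Finset.mem_univ, true_and, Finset.mem_insert]
    tauto
  rw [h, Finset.card_insert_of_notMem]
  simp [Window]

/-- With `M = n - K - 1`, the first `M` windows are full with complement of size `M`, and each
contributes `E (M + 1) - E M`. For the last `K + 1` indices the complement has size `i`, so these
terms telescope to `E n - E M`. -/
lemma sum_window_differences (E : ℕ → ℝ) {K : ℕ} (hK : K < n) :
    ∑ i : Fin n, (E (i + (n - (i + K + 1)) + 1) - E (i + (n - (i + K + 1))))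
      = E n - ((n : ℝ) - K) * E (n - K - 1) + ((n : ℝ) - K - 1) * E (n - K) := by
  obtain ⟨M, rfl⟩ : ∃ M, n = M + (K + 1) := ⟨n - (K + 1), by omega⟩
  rw [Fin.sum_univ_eq_sum_range (fun i => E (i + (M + (K + 1) - (i + K + 1)) + 1)
    - E (i + (M + (K + 1) - (i + K + 1)))) (M + (K + 1)), Finset.sum_range_add]
  have h1 : ∀ i ∈ Finset.range M, E (i + (M + (K + 1) - (i + K + 1)) + 1)
      - E (i + (M + (K + 1) - (i + K + 1))) = E (M + 1) - E M := by
    intro i hi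
    rw [Finset.mem_range] at hi
    have : i + (M + (K + 1) - (i + K + 1)) = M := by omega
    rw [this]
  have h2 : ∀ i ∈ Finset.range (K + 1),
      E (M + i + (M + (K + 1) - (M + i + K + 1)) + 1)
      - E (M + i + (M + (K + 1) - (M + i + K + 1))) = E (M + (i + 1)) - E (M + i) := by
    intro i hi
    have : M + i + (M + (K + 1) - (M + i + K + 1)) = M + i := by omega
    rw [this, add_assoc]
  rw [Finset.sum_congr rfl h1, Finset.sum_congr rfl h2, Finset.sum_const, Finset.card_range,
    Finset.sum_range_sub (fun i => E (M + i))]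
  have h3 : M + (K + 1) - K - 1 = M := by omega
  have h4 : M + (K + 1) - K = M + 1 := by omega
  rw [h3, h4, nsmul_eq_mul, add_zero]
  push_cast
  ring

lemma integrable_csRate (nR nT K : ℕ) {N0 : ℝ} (hN : 0 < N0) :
    Integrable (fun H : Fin nR → Fin nT → ℂ => csRate K N0 (Matrix.of H)) (channelLaw nR nT) := by
  simp only [csRate_eq K hN]
  have ht := (inv_pos.mpr hN).le
  exact integrable_finsetSum _ fun i _ => (integrable_and_integral_log_minorDet ht _).1.sub
    (integrable_and_integral_log_minorDet ht _).1

lemma ergodicCSRate_eq (nR : ℕ) {nT K : ℕ} (hK : K < nT) {snr : ℝ} (hsnr : 0 < snr) :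
    ergodicCSRate nR nT K snr = ergodicLogDet nR nT (snr / nT)
      - ((nT : ℝ) - K) * ergodicLogDet nR (nT - K - 1) (snr / nT)
      + ((nT : ℝ) - K - 1) * ergodicLogDet nR (nT - K) (snr / nT) := by
  have hnT : (0 : ℝ) < nT := by exact_mod_cast (Nat.zero_le K).trans_lt hK
  have hN : 0 < nT / snr := div_pos hnT hsnr
  have ht := (inv_pos.mpr hN).le
  simp only [ergodicCSRate, csRate_eq K hN]
  have hi : ∀ i : Fin nT, Integrable (fun H : Fin nR → Fin nT → ℂ =>
      Real.log (minorDet (regularizedGram (nT / snr)⁻¹ (Matrix.of H)) fun j =>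
        ¬(Window K i j ∧ j ≠ i))
      - Real.log (minorDet (regularizedGram (nT / snr)⁻¹ (Matrix.of H)) fun j => ¬Window K i j))
      (channelLaw nR nT) := fun i => (integrable_and_integral_log_minorDet ht _).1.sub
    (integrable_and_integral_log_minorDet ht _).1
  rw [integral_finsetSum _ fun i _ => hi i,
    ← sum_window_differences (fun m => ergodicLogDet nR m (snr / nT)) hK]
  refine Finset.sum_congr rfl fun i _ => ?_
  rw [integral_sub (integrable_and_integral_log_minorDet ht _).1
    (integrable_and_integral_log_minorDet ht _).1,
    (integrable_and_integral_log_minorDet ht _).2, (integrable_and_integral_log_minorDet ht _).2,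
    card_not_window, card_not_window_erase, inv_div]

/-- The high-SNR slope of the optimized channel shortening detector. -/
noncomputable def csSlope (nR nT K : ℕ) : ℝ :=
  (min nR nT : ℕ) - ((nT : ℝ) - K) * (min nR (nT - K - 1) : ℕ)
    + ((nT : ℝ) - K - 1) * (min nR (nT - K) : ℕ)

/-- The constant term of the high-SNR expansion of the rate in terms of `log (snr / nT)`. -/
noncomputable def csConstant (nR nT K : ℕ) : ℝ :=
  wishartJ nR nT - ((nT : ℝ) - K) * wishartJ nR (nT - K - 1)
    + ((nT : ℝ) - K - 1) * wishartJ nR (nT - K)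

lemma tendsto_ergodicCSRate_sub (nR : ℕ) {nT K : ℕ} (hK : K < nT) :
    Tendsto (fun snr => ergodicCSRate nR nT K snr - csSlope nR nT K * Real.log snr) atTop
      (𝓝 (csConstant nR nT K - csSlope nR nT K * Real.log nT)) := by
  have hnT : (0 : ℝ) < nT := by exact_mod_cast (Nat.zero_le K).trans_lt hK
  have hdiv : Tendsto (fun snr : ℝ => snr / nT) atTop atTop := tendsto_id.atTop_div_const hnT
  have h := (((tendsto_ergodicLogDet_sub nR nT).comp hdiv).sub
    (((tendsto_ergodicLogDet_sub nR (nT - K - 1)).comp hdiv).const_mul ((nT : ℝ) - K))).add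
    (((tendsto_ergodicLogDet_sub nR (nT - K)).comp hdiv).const_mul ((nT : ℝ) - K - 1))
  refine (h.sub_const (csSlope nR nT K * Real.log nT)).congr' ?_
  filter_upwards [eventually_gt_atTop 0] with snr hsnr
  rw [ergodicCSRate_eq nR hK hsnr]
  simp only [Function.comp_apply, Real.log_div hsnr.ne' hnT.ne', csSlope]
  ring

end Rate

end ChannelShortening

theorem mainTheorem9 (nR nT K : ℕ) (hnR : 0 < nR) (hK : K < nT) :
    (∀ snr : ℝ, 0 < snr →
      (∀ H : Matrix (Fin nR) (Fin nT) ℂ,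
        IsGreatest (csRates K (nT / snr) H) (csRate K (nT / snr) H)) ∧
      Integrable (fun H : Fin nR → Fin nT → ℂ => csRate K (nT / snr) (Matrix.of H))
        (channelLaw nR nT)) ∧
    (∀ n ≤ nT, Integrable (fun H : Fin nR → Fin n → ℂ => logDetGram (Matrix.of H))
      (channelLaw nR n)) ∧
    ∃ S : ℝ, IsHighSNRSlope (ergodicCSRate nR nT K) S ∧
      (0 < S → IsHighSNRPowerOffset (ergodicCSRate nR nT K) S
        (Real.log nT - wishartJ nR nT / S
          + ((nT : ℝ) - K) * wishartJ nR (nT - K - 1) / S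
          - ((nT : ℝ) - K - 1) * wishartJ nR (nT - K) / S)) := by
  have hnT : (0 : ℝ) < nT := by exact_mod_cast (Nat.zero_le K).trans_lt hK
  have hlim := ChannelShortening.tendsto_ergodicCSRate_sub nR hK
  refine ⟨fun snr hsnr => ⟨fun H => ?_,
      ChannelShortening.integrable_csRate nR nT K (div_pos hnT hsnr)⟩,
    fun n _ => ChannelShortening.integrable_logDetGram, ChannelShortening.csSlope nR nT K, ?_,
    fun hS => ?_⟩
  · have h := ChannelShortening.isGreatest_csRates K (div_pos hnT hsnr) H
    rwa [csRate, h.csSup_eq]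
  -- `R - S log snr` converges, hence vanishes after division by `log snr`.
  · have h := (hlim.div_atTop Real.tendsto_log_atTop).add_const (ChannelShortening.csSlope nR nT K)
    rw [zero_add] at h
    refine h.congr' ?_
    filter_upwards [eventually_gt_atTop 1] with snr hsnr
    have := (Real.log_pos hsnr).ne'
    field_simp
    ring
  -- The offset expression is `-(R - S log snr) / S`.
  · have h := (hlim.div_const (ChannelShortening.csSlope nR nT K)).neg
    have hS' := hS.ne'
    unfold IsHighSNRPowerOffset
    convert h using 2 with snr
    · field_simp
      ring
    · rw [ChannelShortening.csConstant]
      field_simp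
      ring
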